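/- Let $W:[0,1]^2\to[0,1]$ be a graphon (a symmetric measurable function) with degree function $d(x)=\int_0^1 W(x,y)\,dy$, and let $\|T_W\|$ be the operator norm on $L^2[0,1]$ of $(T_Wf)(x)=\int_0^1W(x,y)f(y)\,dy$. Suppose that $W$ is piecewise Lipschitz: there are a real constant $L$, an integer $K\ge 0$ and points $0=\alpha_0<\alpha_1<\dots<\alpha_{K+1}=1$ such that, with $I_k=[\alpha_{k-1},\alpha_k)$, $|W(x_1,y_1)-W(x_2,y_2)|\le L(|x_1-x_2|+|y_1-y_2|)$ for all $k,\ell$ and all $(x_1,y_1),(x_2,y_2)\in I_k\times I_\ell$. Let $\nu<e^{-1}$, let $N\ge1$ be an integer, and put $$b_N=\frac1N+\sqrt{\frac{8\log(N/\nu)}{N+1}},\qquad \vartheta(N)=2\sqrt{(L^2-K^2)b_N^2+Kb_N},\qquad \phi(N)=\sqrt{\frac{4\log(2N/\nu)}{N}}+\vartheta(N).$$ Suppose that $N$ is large enough, in the sense that $$\frac2N<\min_{1\le k\le K+1}(\alpha_k-\alpha_{k-1}),\qquad \frac1N\log\Big(\frac{2N}{\nu}\Big)+\frac1N(2K+3L)<\sup_{x\in[0,1]}d(x),\qquad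 Ne^{-N/5}<\nu,\qquad 2Kb_N\le1.$$ Let $X_1,\dots,X_N$ be independent and uniformly distributed on $[0,1]$, with order statistics $X_{(1)}\le\dots\le X_{(N)}$, and let $G_N$ be the simple random graph on $\{1,\dots,N\}$ in which, given $X_1,\dots,X_N$, each pair of distinct vertices $i,j$ is joined with probability $W(X_{(i)},X_{(j)})$, independently of the other pairs. Let $\lambda_1\le\dots\le\lambda_N$ be the eigenvalues of the Laplacian matrix of $G_N$ (degree matrix minus adjacency matrix), let $\mu_i=\lambda_i/N$, and for a permutation $\pi$ of $\{1,\dots,N\}$ let $\mu_N^\pi$ be the step function on $[0,1]$ that equals $\mu_{\pi(i)}$ on $[(i-1)/N,i/N)$ for $i<N$ and $\mu_{\pi(N)}$ on $[(N-1)/N,1]$. Then, with probability at least $1-2\nu$, there is a permutation $\pi$ (which may depend on the realization of $G_N$) such that $$\|\mu_N^\pi-d\|_{L^2[0,1]}\le\Big(\frac2N\Big)^{1/4}\sqrt{\|T_W\|+\phi(N)}+\phi(N).$$ -/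

import Mathlib

open MeasureTheory ProbabilityTheory Set
open scoped unitInterval ENNReal

noncomputable section

/-- A graphon: a symmetric measurable function `[0,1]² → [0,1]`. -/
structure Graphon where
  toFun : I → I → ℝ
  measurable' : Measurable (Function.uncurry toFun)
  symm' : ∀ x y, toFun x y = toFun y x
  nonneg' : ∀ x y, 0 ≤ toFun x y
  le_one' : ∀ x y, toFun x y ≤ 1

/-- The `L²[0,1]` norm of a real function on `[0,1]`. -/
def l2Norm (f : I → ℝ) : ℝ := (eLpNorm f 2 (volume : Measure I)).toReal

namespace Graphon

instance : CoeFun Graphon (fun _ => I → I → ℝ) := ⟨Graphon.toFun⟩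

/-- The degree function `d(x) = ∫₀¹ W(x,y) dy`. -/
def degree (W : Graphon) (x : I) : ℝ := ∫ y : I, W x y

/-- The integral operator `(T_W f)(x) = ∫₀¹ W(x,y) f(y) dy`. -/
def op (W : Graphon) (f : I → ℝ) (x : I) : ℝ := ∫ y : I, W x y * f y

/-- The operator norm of `T_W` on `L²[0,1]`, i.e. the supremum of `‖T_W f‖₂` over `‖f‖₂ = 1`. -/
def opNorm (W : Graphon) : ℝ :=
  sSup {r : ℝ | ∃ f : I → ℝ, MemLp f 2 (volume : Measure I) ∧ l2Norm f = 1 ∧ r = l2Norm (W.op f)}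

/-- `W` is piecewise Lipschitz with constant `L` with respect to the partition points
`0 = α₀ < α₁ < ⋯ < α_{K+1} = 1`: it is `L`-Lipschitz (for the `ℓ¹` distance) on each product
`[α_k, α_{k+1}) × [α_l, α_{l+1})`. -/
structure IsPiecewiseLipschitz (W : Graphon) (L : ℝ) (K : ℕ) (α : Fin (K + 2) → ℝ) : Prop where
  strictMono : StrictMono α
  zero : α 0 = 0
  last : α (Fin.last (K + 1)) = 1
  lipschitz : ∀ k l : Fin (K + 1), ∀ x₁ x₂ y₁ y₂ : I,
    (x₁ : ℝ) ∈ Ico (α k.castSucc) (α k.succ) → (x₂ : ℝ) ∈ Ico (α k.castSucc) (α k.succ) →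
    (y₁ : ℝ) ∈ Ico (α l.castSucc) (α l.succ) → (y₂ : ℝ) ∈ Ico (α l.castSucc) (α l.succ) →
    |W x₁ y₁ - W x₂ y₂| ≤ L * (|(x₁ : ℝ) - x₂| + |(y₁ : ℝ) - y₂|)

/-- The conditions under which `N` is large enough, for a graphon that is piecewise Lipschitz with
data `L`, `K`, `α`, and for the probability level `ν`. -/
structure LargeEnough (W : Graphon) (L : ℝ) (K : ℕ) (α : Fin (K + 2) → ℝ) (ν : ℝ) (N : ℕ) :
    Prop where
  gap : ∀ k : Fin (K + 1), 2 / (N : ℝ) < α k.succ - α k.castSucc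
  degree : 1 / (N : ℝ) * Real.log (2 * N / ν) + 1 / (N : ℝ) * (2 * K + 3 * L) < ⨆ x : I, W.degree x
  exp : (N : ℝ) * Real.exp (-(N : ℝ) / 5) < ν

end Graphon

/-- `b_N = 1/N + √(8 log(N/ν)/(N+1))`. -/
def bRate (ν : ℝ) (N : ℕ) : ℝ := 1 / (N : ℝ) + √(8 * Real.log (N / ν) / (N + 1))

/-- `ϑ(N) = 2 √((L² - K²) b_N² + K b_N)`. -/
def thetaRate (L : ℝ) (K : ℕ) (ν : ℝ) (N : ℕ) : ℝ :=
  2 * √((L ^ 2 - (K : ℝ) ^ 2) * bRate ν N ^ 2 + K * bRate ν N)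

/-- `ϕ(N) = √(4 log(2N/ν)/N) + ϑ(N)`. -/
def phiRate (L : ℝ) (K : ℕ) (ν : ℝ) (N : ℕ) : ℝ :=
  √(4 * Real.log (2 * N / ν) / N) + thetaRate L K ν N

/-- The order statistics `x_(1) ≤ ⋯ ≤ x_(N)` of a sample (indexed from `0`). -/
def orderStat {N : ℕ} (x : Fin N → I) (i : Fin N) : I := x (Tuple.sort x i)

open Classical in
/-- The conditional probability of the graph `g`, given the sample `x`: each pair of vertices
`i < j` is joined with probability `W(x_(i), x_(j))`, independently of the other pairs. -/
def graphProb {N : ℕ} (W : Graphon) (x : Fin N → I) (g : SimpleGraph (Fin N)) : ℝ :=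
  ∏ i : Fin N, ∏ j ∈ Finset.Ioi i,
    if g.Adj i j then W (orderStat x i) (orderStat x j)
    else 1 - W (orderStat x i) (orderStat x j)

/-- `G` is a random graph sampled from `W` through the latent variables `X`: the `X i` are
independent and uniform on `[0,1]`, and given `X` the graph `G` has the conditional law
`graphProb W X`. -/
structure IsSampledGraph {Ω : Type*} [MeasurableSpace Ω] (P : Measure Ω) {N : ℕ} (W : Graphon)
    (X : Fin N → Ω → I) (G : Ω → SimpleGraph (Fin N)) : Prop where
  measurable_latent : ∀ i, Measurable (X i)
  uniform : ∀ i, P.map (X i) = (volume : Measure I)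
  indep : iIndepFun X P
  measurable_graph : ∀ g, MeasurableSet {ω | G ω = g}
  cond_law : ∀ (g : SimpleGraph (Fin N)) (B : Set (Fin N → I)), MeasurableSet B →
    P ({ω | (fun i => X i ω) ∈ B} ∩ {ω | G ω = g}) =
      ∫⁻ ω in {ω | (fun i => X i ω) ∈ B}, ENNReal.ofReal (graphProb W (fun i => X i ω) g) ∂P

open Classical in
/-- The eigenvalues `λ_1 ≤ ⋯ ≤ λ_N` of the Laplacian matrix of a graph, with multiplicity
(indexed from `0`). -/
def laplacianEigenvalue {N : ℕ} (g : SimpleGraph (Fin N)) (i : Fin N) : ℝ :=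
  let e : Fin N → ℝ := (SimpleGraph.posSemidef_lapMatrix ℝ g).isHermitian.eigenvalues
  e (Tuple.sort e i)

/-- The normalized Laplacian eigenvalues `μ_i = λ_i / N`. -/
def normalizedEigenvalue {N : ℕ} (g : SimpleGraph (Fin N)) (i : Fin N) : ℝ :=
  laplacianEigenvalue g i / N

/-- The cells of the uniform partition of `[0,1]`, indexed from `0`: `[i/N, (i+1)/N)`, where the
last cell also contains `1`. -/
def cell (N : ℕ) (i : Fin N) : Set I :=
  {x | (i : ℝ) / N ≤ x ∧ ((x : ℝ) < ((i : ℝ) + 1) / N ∨ (i : ℕ) + 1 = N)}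

/-- The step function `μ_N^π(x) = ∑ μ_{π(i)} 1_{B_i}(x)`. -/
def eigenvalueStep {N : ℕ} (g : SimpleGraph (Fin N)) (π : Equiv.Perm (Fin N)) (x : I) : ℝ :=
  ∑ i : Fin N, (cell N i).indicator (fun _ => normalizedEigenvalue g (π i)) x

end

/-! The Laplacian is its diagonal of vertex degrees minus a 0/1 matrix. Hoffman–Wielandt, applied to
a symmetric matrix and its own diagonal, matches eigenvalues with degrees at a squared cost equal to
the off-diagonal mass, which here is the total degree. After rescaling, the cost in `L²` is the
square root of the edge density over `N`. The density is at most `‖d‖₂` plus the `L²` distance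
between normalized degrees and `d`, and `‖d‖₂ ≤ ‖T_W‖` because `d = T_W 1`. So it suffices to show
that the normalized degrees are `phiRate`-close to `d` in `L²`; see
`exists_perm_l2Norm_eigenvalueStep_sub_degree_le`.

Two events, each failing with probability at most `ν`, give this. By Hoeffding, all order statistics
lie within `bRate` of their grid cells. The piecewise Lipschitz condition then bounds the distance
between `d` and the degrees of the weighted graph by `thetaRate`, the loss coming from the
neighbourhoods of the `K` interior breakpoints. By a Chernoff bound conditional on the sample, all
degrees of the random graph are close to those of the weighted graph; this and the missing diagonal
fit in the first term of `phiRate`. -/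

noncomputable section

/-! ### Eigenvalues and diagonal entries of a symmetric matrix -/

namespace Matrix.IsHermitian

variable {n : Type*} [Fintype n] [DecidableEq n] {A : Matrix n n ℝ}

theorem apply_eq_sum_eigenvalues (hA : A.IsHermitian) (i j : n) :
    A i j = ∑ k, hA.eigenvectorUnitary i k * hA.eigenvalues k * hA.eigenvectorUnitary j k := by
  conv_lhs => rw [hA.spectral_theorem]
  rw [Unitary.conjStarAlgAut_apply, Matrix.mul_apply]
  refine Finset.sum_congr rfl fun k _ => ?_
  rw [Matrix.mul_diagonal, Matrix.star_apply]
  simp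

/-- Rows and columns of an orthogonal matrix are unit vectors. By Birkhoff's theorem this lets
permutations replace the eigenvector matrix. -/
theorem eigenvectorUnitary_sq_mem_doublyStochastic (hA : A.IsHermitian) :
    (Matrix.of fun i k => (hA.eigenvectorUnitary i k : ℝ) ^ 2) ∈ doublyStochastic ℝ n := by
  rw [mem_doublyStochastic_iff_sum]
  refine ⟨fun i j => sq_nonneg _, fun i => ?_, fun j => ?_⟩
  · have h := congr_fun (congr_fun (Unitary.coe_mul_star_self hA.eigenvectorUnitary) i) i
    rw [Matrix.mul_apply, Matrix.one_apply_eq] at h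
    rw [← h]
    refine Finset.sum_congr rfl fun k _ => ?_
    rw [Matrix.of_apply, sq]
    rfl
  · have h := congr_fun (congr_fun (Unitary.coe_star_mul_self hA.eigenvectorUnitary) j) j
    rw [Matrix.mul_apply, Matrix.one_apply_eq] at h
    rw [← h]
    refine Finset.sum_congr rfl fun k _ => ?_
    rw [Matrix.of_apply, sq]
    rfl

/-- Both sides are the trace of `A * A`. -/
theorem sum_sq_apply_eq_sum_sq_eigenvalues (hA : A.IsHermitian) :
    ∑ i, ∑ j, A i j ^ 2 = ∑ k, hA.eigenvalues k ^ 2 := by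
  have h1 : (A * A).trace = ∑ i, ∑ j, A i j ^ 2 := by
    simp only [Matrix.trace, Matrix.diag_apply, Matrix.mul_apply]
    refine Finset.sum_congr rfl fun i _ => Finset.sum_congr rfl fun j _ => ?_
    rw [← hA.apply i j, star_trivial, sq]
  rw [← h1]
  conv_lhs => rw [hA.spectral_theorem]
  rw [← map_mul, Unitary.conjStarAlgAut_apply, Matrix.trace_mul_cycle,
    Unitary.coe_star_mul_self, one_mul, Matrix.diagonal_mul_diagonal, Matrix.trace_diagonal]
  simp [sq]

/-- The **Hoffman–Wielandt inequality** for a Hermitian matrix and its diagonal: the eigenvalues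
can be matched with the diagonal entries up to the sum of the squared off-diagonal entries. -/
theorem exists_perm_sum_sq_eigenvalues_sub_diag_le (hA : A.IsHermitian) :
    ∃ π : Equiv.Perm n, ∑ i, (hA.eigenvalues (π i) - A i i) ^ 2 ≤
      ∑ i, ∑ j, A i j ^ 2 - ∑ i, A i i ^ 2 := by
  set S : Matrix n n ℝ := Matrix.of fun i k => (hA.eigenvectorUnitary i k : ℝ) ^ 2 with hS
  have hmem := hA.eigenvectorUnitary_sq_mem_doublyStochastic
  rw [← SetLike.mem_coe, doublyStochastic_eq_convexHull_permMatrix] at hmem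
  -- The correlation of diagonal and eigenvalues, extended linearly from permutations to doubly
  -- stochastic matrices. At `S` it equals `∑ A i i ^ 2`, and a linear functional does at least as
  -- well at some vertex of the Birkhoff polytope.
  let F : Matrix n n ℝ →ₗ[ℝ] ℝ :=
    { toFun := fun M => ∑ i, ∑ k, A i i * (M i k * hA.eigenvalues k)
      map_add' := fun M M' => by
        simp only [← Finset.sum_add_distrib, Matrix.add_apply]
        exact Finset.sum_congr rfl fun i _ => Finset.sum_congr rfl fun k _ => by ring
      map_smul' := fun c M => by
        simp only [Finset.mul_sum, Matrix.smul_apply, smul_eq_mul, RingHom.id_apply]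
        exact Finset.sum_congr rfl fun i _ => Finset.sum_congr rfl fun k _ => by ring }
  obtain ⟨_, ⟨τ, rfl⟩, hs⟩ :=
    (F.convexOn convex_univ).exists_ge_of_mem_convexHull (subset_univ _) hmem
  have hS' : F S = ∑ i, A i i ^ 2 := by
    change ∑ i, ∑ k, A i i * (S i k * hA.eigenvalues k) = _
    refine Finset.sum_congr rfl fun i _ => ?_
    rw [← Finset.mul_sum, sq]
    congr 1
    rw [hA.apply_eq_sum_eigenvalues i i]
    refine Finset.sum_congr rfl fun k _ => ?_
    rw [hS, Matrix.of_apply]; ring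
  have hP : F (τ.permMatrix ℝ) = ∑ i, A i i * hA.eigenvalues (τ i) := by
    change ∑ i, ∑ k, A i i * (τ.permMatrix ℝ i k * hA.eigenvalues k) = _
    refine Finset.sum_congr rfl fun i _ => ?_
    simp [Equiv.Perm.permMatrix, PEquiv.toMatrix_apply, Equiv.toPEquiv_apply]
  refine ⟨τ, ?_⟩
  rw [hS', hP] at hs
  have hperm : ∑ i, hA.eigenvalues (τ i) ^ 2 = ∑ k, hA.eigenvalues k ^ 2 :=
    Equiv.sum_comp τ fun k => hA.eigenvalues k ^ 2
  have hexp : ∑ i, (hA.eigenvalues (τ i) - A i i) ^ 2 = ∑ i, hA.eigenvalues (τ i) ^ 2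
      - 2 * ∑ i, A i i * hA.eigenvalues (τ i) + ∑ i, A i i ^ 2 := by
    rw [Finset.mul_sum, ← Finset.sum_sub_distrib, ← Finset.sum_add_distrib]
    exact Finset.sum_congr rfl fun i _ => by ring
  rw [hexp, hperm, hA.sum_sq_apply_eq_sum_sq_eigenvalues]
  linarith

end Matrix.IsHermitian

/-! ### Laplacian eigenvalues and vertex degrees -/

open Classical in
/-- The degree of a vertex, as a real number. -/
def vertexDegree {N : ℕ} (g : SimpleGraph (Fin N)) (i : Fin N) : ℝ :=
  ∑ j, if g.Adj i j then 1 else 0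

/-- The Laplacian eigenvalues can be matched with the vertex degrees, up to the square root of the
total degree. -/
theorem exists_perm_sum_sq_laplacianEigenvalue_sub_le {N : ℕ} (g : SimpleGraph (Fin N)) :
    ∃ π : Equiv.Perm (Fin N),
      ∑ i, (laplacianEigenvalue g (π i) - vertexDegree g i) ^ 2 ≤ ∑ i, vertexDegree g i := by
  classical
  let hA := (SimpleGraph.posSemidef_lapMatrix ℝ g).isHermitian
  obtain ⟨τ, hs⟩ := hA.exists_perm_sum_sq_eigenvalues_sub_diag_le
  have hdeg : ∀ i, (g.degree i : ℝ) = vertexDegree g i := fun i => by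
    rw [vertexDegree, ← SimpleGraph.card_neighborFinset_eq_degree,
      SimpleGraph.neighborFinset_eq_filter, Finset.sum_boole]
  have hentry : ∀ i j, g.lapMatrix ℝ i j =
      (if i = j then vertexDegree g i else 0) - if g.Adj i j then 1 else 0 := fun i j => by
    rw [SimpleGraph.lapMatrix, Matrix.sub_apply, SimpleGraph.degMatrix, Matrix.diagonal_apply,
      SimpleGraph.adjMatrix_apply, hdeg]
  have hdiag : ∀ i, g.lapMatrix ℝ i i = vertexDegree g i := fun i => by simp [hentry]
  have hrow : ∀ i, ∑ j, g.lapMatrix ℝ i j ^ 2 = vertexDegree g i ^ 2 + vertexDegree g i :=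
    fun i => by
    have : ∀ j, g.lapMatrix ℝ i j ^ 2 =
        (if i = j then vertexDegree g i ^ 2 else 0) + if g.Adj i j then 1 else 0 := fun j => by
      rw [hentry]
      by_cases h : i = j
      · subst h; simp
      · simp only [h, if_false]; split_ifs <;> norm_num
    rw [Finset.sum_congr rfl fun j _ => this j, Finset.sum_add_distrib, Finset.sum_ite_eq]
    simp [vertexDegree]
  -- The inverse sort converts from the indexing of `eigenvalues` to the increasing order.
  refine ⟨τ.trans (Tuple.sort hA.eigenvalues).symm, ?_⟩
  have hval : ∀ i, laplacianEigenvalue g (τ.trans (Tuple.sort hA.eigenvalues).symm i) =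
      hA.eigenvalues (τ i) := fun i => by
    have : ∀ k, laplacianEigenvalue g k = hA.eigenvalues (Tuple.sort hA.eigenvalues k) := by
      intro k
      simp only [laplacianEigenvalue]
    rw [this]; simp
  simp only [hval]
  simp only [hdiag, hrow, Finset.sum_add_distrib] at hs
  linarith

/-! ### The `L²` norm on the unit interval -/

theorem l2Norm_nonneg (f : I → ℝ) : 0 ≤ l2Norm f := ENNReal.toReal_nonneg

theorem l2Norm_sq_eq {f : I → ℝ} (hf : MemLp f 2 (volume : Measure I)) :
    l2Norm f ^ 2 = ∫ x, f x ^ 2 := by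
  have h0 : 0 ≤ ∫ x, f x ^ 2 := integral_nonneg fun x => sq_nonneg _
  rw [l2Norm, hf.eLpNorm_eq_integral_rpow_norm two_ne_zero ENNReal.ofNat_ne_top]
  have : ∫ x, ‖f x‖ ^ (2 : ℝ≥0∞).toReal = ∫ x, f x ^ 2 := by
    refine integral_congr_ae (Filter.Eventually.of_forall fun x => ?_)
    simp
  rw [this, ENNReal.toReal_ofReal (Real.rpow_nonneg h0 _)]
  simp only [ENNReal.toReal_ofNat]
  rw [← Real.rpow_mul_natCast h0]
  norm_num

theorem l2Norm_add_le {f g : I → ℝ} (hf : MemLp f 2 (volume : Measure I))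
    (hg : MemLp g 2 (volume : Measure I)) :
    l2Norm (fun x => f x + g x) ≤ l2Norm f + l2Norm g := by
  rw [l2Norm, l2Norm, l2Norm, ← ENNReal.toReal_add hf.2.ne hg.2.ne]
  exact ENNReal.toReal_mono (ENNReal.add_ne_top.2 ⟨hf.2.ne, hg.2.ne⟩)
    (eLpNorm_add_le hf.1 hg.1 one_le_two)

theorem l2Norm_le_of_abs_le {f : I → ℝ} {C : ℝ} (hC : 0 ≤ C) (h : ∀ x, |f x| ≤ C) :
    l2Norm f ≤ C := by
  have := eLpNorm_le_of_ae_bound (p := 2) (μ := (volume : Measure I))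
    (f := f) (C := C) (Filter.Eventually.of_forall h)
  rw [measure_univ, ENNReal.one_rpow, one_mul] at this
  exact ENNReal.toReal_le_of_le_ofReal hC this

theorem sq_integral_le_integral_sq {f : I → ℝ} (hf : MemLp f 2 (volume : Measure I)) :
    (∫ x, f x) ^ 2 ≤ ∫ x, f x ^ 2 := by
  have h := variance_nonneg f (volume : Measure I)
  rw [variance_eq_sub hf] at h
  simpa using h

theorem abs_integral_le_l2Norm {f : I → ℝ} (hf : MemLp f 2 (volume : Measure I)) :
    |∫ x, f x| ≤ l2Norm f :=
  abs_le_of_sq_le_sq ((sq_integral_le_integral_sq hf).trans_eq (l2Norm_sq_eq hf).symm)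
    (l2Norm_nonneg f)

theorem memLp_two_of_abs_le {f : I → ℝ} (hf : Measurable f) {C : ℝ} (h : ∀ x, |f x| ≤ C) :
    MemLp f 2 (volume : Measure I) :=
  MemLp.of_bound hf.aestronglyMeasurable C (Filter.Eventually.of_forall h)

/-! ### Degree function and integral operator -/

namespace Graphon

variable (W : Graphon)

theorem measurable_right (x : I) : Measurable (W x) :=
  W.measurable'.comp measurable_prodMk_left

theorem abs_le_one (x y : I) : |W x y| ≤ 1 :=
  abs_le.2 ⟨by linarith [W.nonneg' x y], W.le_one' x y⟩

theorem integrable_right (x : I) : Integrable (W x) (volume : Measure I) :=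
  (memLp_two_of_abs_le (W.measurable_right x) (W.abs_le_one x)).integrable one_le_two

theorem measurable_degree : Measurable W.degree :=
  (W.measurable'.stronglyMeasurable.integral_prod_right (ν := (volume : Measure I))).measurable

theorem degree_nonneg (x : I) : 0 ≤ W.degree x := integral_nonneg fun y => W.nonneg' x y

theorem degree_le_one (x : I) : W.degree x ≤ 1 := by
  have := integral_mono (W.integrable_right x) (integrable_const (1 : ℝ)) (W.le_one' x)
  simpa [degree] using this

theorem memLp_degree : MemLp W.degree 2 (volume : Measure I) :=
  memLp_two_of_abs_le W.measurable_degree (C := 1) fun x =>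
    abs_le.2 ⟨by linarith [W.degree_nonneg x], W.degree_le_one x⟩

/-- Since `|W| ≤ 1`, the `L¹` norm of `f` is a bound. This makes the set defining `opNorm` bounded
above, without which its `sSup` would be a junk value. -/
theorem abs_op_le (f : I → ℝ) (hf : MemLp f 2 (volume : Measure I)) (x : I) :
    |W.op f x| ≤ l2Norm f := by
  have hi : Integrable f (volume : Measure I) := hf.integrable one_le_two
  have hn : l2Norm (fun y => abs (f y)) = l2Norm f := by
    rw [l2Norm, l2Norm]; congr 1; exact eLpNorm_norm f
  calc |W.op f x| ≤ ∫ y, abs (W x y * f y) := abs_integral_le_integral_abs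
    _ ≤ ∫ y, abs (f y) := by
        refine integral_mono_of_nonneg (Filter.Eventually.of_forall fun y => abs_nonneg _) hi.abs
          (Filter.Eventually.of_forall fun y => ?_)
        simp only [abs_mul]
        exact mul_le_of_le_one_left (abs_nonneg _) (W.abs_le_one x y)
    _ ≤ abs (∫ y, abs (f y)) := le_abs_self _
    _ ≤ l2Norm (fun y => abs (f y)) := abs_integral_le_l2Norm hf.abs
    _ = l2Norm f := hn

/-- The degree function is the image under `T_W` of the constant function 1, which has norm 1. -/
theorem l2Norm_degree_le_opNorm : l2Norm W.degree ≤ W.opNorm := by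
  refine le_csSup ⟨1, ?_⟩ ⟨fun _ => 1, memLp_const 1, ?_, ?_⟩
  · rintro _ ⟨f, hf, h1, rfl⟩
    exact l2Norm_le_of_abs_le zero_le_one fun x => h1 ▸ W.abs_op_le f hf x
  · have := l2Norm_sq_eq (memLp_const (1 : ℝ) (p := 2) (μ := (volume : Measure I)))
    simp only [one_pow, integral_const, probReal_univ, smul_eq_mul, mul_one] at this
    nlinarith [l2Norm_nonneg fun _ : I => (1 : ℝ)]
  · congr 1
    ext x
    simp [degree, op]

end Graphon

/-! ### The uniform partition and its step functions -/

theorem exists_mem_cell {N : ℕ} (hN : 0 < N) (x : I) : ∃ i, x ∈ cell N i := by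
  have hN' : (0 : ℝ) < N := Nat.cast_pos.2 hN
  have hx0 : (0 : ℝ) ≤ x * N := mul_nonneg x.2.1 hN'.le
  by_cases h : ⌊(x : ℝ) * N⌋₊ < N
  · refine ⟨⟨_, h⟩, ?_, Or.inl ?_⟩
    · rw [div_le_iff₀ hN']; exact Nat.floor_le hx0
    · rw [lt_div_iff₀ hN']; exact Nat.lt_floor_add_one _
  · refine ⟨⟨N - 1, by omega⟩, ?_, Or.inr ?_⟩
    · rw [div_le_iff₀ hN']
      have : ((N - 1 : ℕ) : ℝ) ≤ (⌊(x : ℝ) * N⌋₊ : ℝ) := by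
        exact_mod_cast (by omega : N - 1 ≤ ⌊(x : ℝ) * N⌋₊)
      exact this.trans (Nat.floor_le hx0)
    · simp only []; omega

theorem mem_cell_le {N : ℕ} {i : Fin N} {x : I} (h : x ∈ cell N i) :
    (i : ℝ) / N ≤ x ∧ (x : ℝ) ≤ ((i : ℝ) + 1) / N := by
  refine ⟨h.1, h.2.elim le_of_lt fun h' => ?_⟩
  have hN : (0 : ℝ) < N := Nat.cast_pos.2 i.pos
  have : ((i : ℝ) + 1) = N := by exact_mod_cast h'
  rw [this, div_self hN.ne']
  exact x.2.2

theorem eq_of_mem_cell {N : ℕ} {i j : Fin N} {x : I} (hi : x ∈ cell N i) (hj : x ∈ cell N j) :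
    i = j := by
  have hN : (0 : ℝ) < N := Nat.cast_pos.2 i.pos
  have key : ∀ {i j : Fin N}, x ∈ cell N i → x ∈ cell N j → ¬ i < j := by
    intro i j hi hj hij
    rcases hi.2 with h | h
    · have h' := hj.1.trans_lt h
      rw [div_lt_div_iff_of_pos_right hN] at h'
      have : (j : ℕ) < i + 1 := by exact_mod_cast h'
      have : (i : ℕ) < j := hij
      omega
    · have : (i : ℕ) < j := hij
      have := j.2
      omega
  exact le_antisymm (not_lt.1 (key hj hi)) (not_lt.1 (key hi hj))

theorem measurableSet_cell (N : ℕ) (i : Fin N) : MeasurableSet (cell N i) := by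
  have h1 : Measurable fun x : I => (x : ℝ) := measurable_subtype_coe
  exact (measurableSet_le measurable_const h1).inter
    ((measurableSet_lt h1 measurable_const).union (MeasurableSet.const _))

theorem volume_real_cell {N : ℕ} (i : Fin N) :
    (volume : Measure I).real (cell N i) = 1 / N := by
  have hN : (0 : ℝ) < N := Nat.cast_pos.2 i.pos
  have hi : (i : ℝ) + 1 ≤ N := by exact_mod_cast i.2
  have ha : (i : ℝ) / N ∈ I := ⟨by positivity, by rw [div_le_one hN]; linarith⟩
  have hb : ((i : ℝ) + 1) / N ∈ I := ⟨by positivity, by rwa [div_le_one hN]⟩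
  have hlo : Ico (⟨_, ha⟩ : I) ⟨_, hb⟩ ⊆ cell N i := fun x hx => ⟨hx.1, Or.inl hx.2⟩
  have hhi : cell N i ⊆ Icc (⟨_, ha⟩ : I) ⟨_, hb⟩ := fun x hx => mem_cell_le hx
  have hv : (volume : Measure I) (cell N i) = ENNReal.ofReal (1 / N) := by
    have he : ((i : ℝ) + 1) / N - i / N = 1 / N := by ring
    refine le_antisymm ((measure_mono hhi).trans_eq ?_) ((Eq.symm ?_).trans_le (measure_mono hlo))
    · rw [unitInterval.volume_Icc]; exact congrArg _ he
    · rw [unitInterval.volume_Ico]; exact congrArg _ he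
  rw [measureReal_def, hv, ENNReal.toReal_ofReal (by positivity)]

/-- The step function on `[0,1]` with value `c i` on the `i`-th cell of the uniform partition. -/
def cellStep (N : ℕ) (c : Fin N → ℝ) (x : I) : ℝ :=
  ∑ i : Fin N, (cell N i).indicator (fun _ => c i) x

theorem cellStep_of_mem {N : ℕ} (c : Fin N → ℝ) {i : Fin N} {x : I} (h : x ∈ cell N i) :
    cellStep N c x = c i := by
  rw [cellStep, Finset.sum_eq_single i, indicator_of_mem h]
  · intro j _ hj
    exact indicator_of_notMem (fun hj' => hj (eq_of_mem_cell hj' h)) _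
  · simp

theorem measurable_cellStep {N : ℕ} (c : Fin N → ℝ) : Measurable (cellStep N c) :=
  Finset.measurable_fun_sum _ fun i _ => measurable_const.indicator (measurableSet_cell N i)

theorem abs_cellStep_le {N : ℕ} (hN : 0 < N) {c : Fin N → ℝ} {C : ℝ} (h : ∀ i, |c i| ≤ C)
    (x : I) : |cellStep N c x| ≤ C := by
  obtain ⟨i, hi⟩ := exists_mem_cell hN x
  rw [cellStep_of_mem c hi]
  exact h i

theorem memLp_cellStep {N : ℕ} (hN : 0 < N) (c : Fin N → ℝ) :
    MemLp (cellStep N c) 2 (volume : Measure I) :=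
  memLp_two_of_abs_le (measurable_cellStep c) (C := ∑ i, |c i|) <| abs_cellStep_le hN fun i =>
    Finset.single_le_sum (f := fun i => |c i|) (fun j _ => abs_nonneg (c j)) (Finset.mem_univ i)

theorem integral_cellStep {N : ℕ} (c : Fin N → ℝ) :
    ∫ x, cellStep N c x = (∑ i, c i) / N := by
  simp only [cellStep]
  rw [integral_finsetSum _ fun i _ => (integrable_const _).indicator (measurableSet_cell N i),
    Finset.sum_div]
  refine Finset.sum_congr rfl fun i _ => ?_
  rw [integral_indicator (measurableSet_cell N i), setIntegral_const, volume_real_cell]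
  rw [smul_eq_mul]; ring

theorem cellStep_map {N : ℕ} (hN : 0 < N) (F : ℝ → ℝ) (c : Fin N → ℝ) (x : I) :
    F (cellStep N c x) = cellStep N (fun i => F (c i)) x := by
  obtain ⟨i, hi⟩ := exists_mem_cell hN x
  rw [cellStep_of_mem _ hi, cellStep_of_mem _ hi]

theorem cellStep_sub {N : ℕ} (c c' : Fin N → ℝ) (x : I) :
    cellStep N c x - cellStep N c' x = cellStep N (fun i => c i - c' i) x := by
  simp only [cellStep, ← Finset.sum_sub_distrib]
  exact Finset.sum_congr rfl fun i _ => by by_cases h : x ∈ cell N i <;> simp [h]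

theorem l2Norm_cellStep_sq {N : ℕ} (hN : 0 < N) (c : Fin N → ℝ) :
    l2Norm (cellStep N c) ^ 2 = (∑ i, c i ^ 2) / N := by
  rw [l2Norm_sq_eq (memLp_cellStep hN c)]
  simp only [cellStep_map hN (fun t => t ^ 2) c]
  exact integral_cellStep _

/-! ### Approximating the degree function of a piecewise Lipschitz graphon -/

theorem exists_mem_Ico_of_partition {K : ℕ} {α : Fin (K + 2) → ℝ} {u : ℝ} (h0 : α 0 ≤ u)
    (h1 : u < α (Fin.last (K + 1))) :
    ∃ k : Fin (K + 1), u ∈ Ico (α k.castSucc) (α k.succ) := by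
  by_contra! h
  have : ∀ k : Fin (K + 2), α k ≤ u := by
    intro k
    induction k using Fin.induction with
    | zero => exact h0
    | succ k ih => exact not_lt.1 fun hlt => h k ⟨ih, hlt⟩
  exact (this _).not_gt h1

theorem volume_real_abs_sub_le (a b : ℝ) (hb : 0 ≤ b) :
    (volume : Measure I).real {u : I | |(u : ℝ) - a| ≤ b} ≤ 2 * b := by
  rw [measureReal_def, unitInterval.volume_apply]
  refine ENNReal.toReal_le_of_le_ofReal (by positivity) ?_
  refine (measure_mono (t := Icc (a - b) (a + b)) ?_).trans_eq ?_
  · rintro _ ⟨u, hu, rfl⟩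
    have := abs_le.1 (show |(u : ℝ) - a| ≤ b from hu)
    exact ⟨by linarith, by linarith⟩
  · rw [Real.volume_Icc]; congr 1; ring

namespace Graphon

variable {W : Graphon} {L : ℝ} {K : ℕ} {α : Fin (K + 2) → ℝ}

/-- The first interval contains two distinct points, 0 and its midpoint. -/
theorem IsPiecewiseLipschitz.lipschitz_nonneg (hW : W.IsPiecewiseLipschitz L K α) : 0 ≤ L := by
  have h01 : α (0 : Fin (K + 1)).castSucc < α (0 : Fin (K + 1)).succ :=
    hW.strictMono Fin.castSucc_lt_succ
  have h0 : α (0 : Fin (K + 1)).castSucc = 0 := hW.zero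
  have h1 : α (0 : Fin (K + 1)).succ ≤ 1 := by
    rw [← hW.last]; exact hW.strictMono.monotone (Fin.le_last _)
  rw [h0] at h01
  set a := α (0 : Fin (K + 1)).succ
  have hm : a / 2 ∈ I := ⟨by linarith, by linarith⟩
  have hI0 : ((0 : I) : ℝ) ∈ Ico (α (0 : Fin (K + 1)).castSucc) a := by
    rw [h0]; exact ⟨le_rfl, h01⟩
  have hI1 : ((⟨_, hm⟩ : I) : ℝ) ∈ Ico (α (0 : Fin (K + 1)).castSucc) a := by
    rw [h0]; exact ⟨hm.1, by simp only []; linarith⟩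
  have := (abs_nonneg _).trans (hW.lipschitz 0 0 0 ⟨_, hm⟩ 0 0 hI0 hI1 hI0 hI0)
  refine nonneg_of_mul_nonneg_left this ?_
  have : (0 : ℝ) < |((0 : I) : ℝ) - a / 2| := by
    rw [Icc.coe_zero, zero_sub, abs_neg, abs_of_pos] <;> linarith
  exact add_pos_of_pos_of_nonneg this (abs_nonneg _)

/-- The points of `[0,1]` within distance `b` of an interior point of the partition. -/
def nearPartition (α : Fin (K + 2) → ℝ) (b : ℝ) : Set I :=
  ⋃ k : Fin K, {u : I | |(u : ℝ) - α k.succ.castSucc| ≤ b}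

theorem measurableSet_nearPartition (α : Fin (K + 2) → ℝ) (b : ℝ) :
    MeasurableSet (nearPartition α b) := by
  refine MeasurableSet.iUnion fun k => measurableSet_le ?_ measurable_const
  exact (continuous_abs.comp (continuous_subtype_val.sub continuous_const)).measurable

theorem volume_real_nearPartition_le (α : Fin (K + 2) → ℝ) {b : ℝ} (hb : 0 ≤ b) :
    (volume : Measure I).real (nearPartition α b) ≤ 2 * K * b := by
  refine (measureReal_iUnion_fintype_le _).trans ?_
  refine (Finset.sum_le_sum fun k _ => volume_real_abs_sub_le _ b hb).trans_eq ?_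
  simp; ring

/-- A move of length at most `b` cannot cross an interior breakpoint that is farther than `b` away,
and the outer endpoints 0 and 1 cannot be crossed within `[0,1)`. -/
theorem IsPiecewiseLipschitz.exists_mem_Ico_of_notMem_nearPartition
    (hW : W.IsPiecewiseLipschitz L K α) {b : ℝ} {u v : I} (hu : (u : ℝ) < 1) (hv : (v : ℝ) < 1)
    (huv : |(v : ℝ) - u| ≤ b) (hn : u ∉ nearPartition α b) :
    ∃ k : Fin (K + 1), (u : ℝ) ∈ Ico (α k.castSucc) (α k.succ) ∧
      (v : ℝ) ∈ Ico (α k.castSucc) (α k.succ) := by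
  obtain ⟨k, hk⟩ := exists_mem_Ico_of_partition (α := α) (u := u) (by rw [hW.zero]; exact u.2.1)
    (by rwa [hW.last])
  have hn' : ∀ j : Fin K, b < |(u : ℝ) - α j.succ.castSucc| := fun j => by
    by_contra! h
    exact hn (mem_iUnion.2 ⟨j, h⟩)
  have huv' := abs_le.1 huv
  refine ⟨k, hk, ?_, ?_⟩
  · by_contra! h
    rcases Fin.eq_zero_or_eq_succ k with rfl | ⟨j, rfl⟩
    · rw [Fin.castSucc_zero, hW.zero] at h
      exact absurd v.2.1 (not_le.2 h)
    · refine (hn' j).not_ge ?_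
      rw [abs_of_nonneg (by linarith [hk.1])]
      linarith
  · by_contra! h
    rcases Fin.eq_castSucc_or_eq_last k with ⟨j, rfl⟩ | rfl
    · have h2 := hn' j
      have h3 := hk.2
      rw [← Fin.succ_castSucc] at h2
      refine h2.not_ge ?_
      rw [abs_of_nonpos (by linarith)]
      linarith
    · rw [Fin.succ_last, hW.last] at h
      exact absurd hv (not_lt.2 h)

variable {N : ℕ}

/-- The degree of a vertex in the weighted graph sampled from `W` at the points `y`, divided by the
number of vertices. -/
def sampleDegree (W : Graphon) (y : Fin N → I) (i : Fin N) : ℝ := (∑ j, W (y i) (y j)) / N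

theorem abs_cellStep_sampleDegree_sub_degree_le (W : Graphon) (hN : 0 < N) (y : Fin N → I)
    (x : I) : |cellStep N (W.sampleDegree y) x - W.degree x| ≤ 1 := by
  have hN' : (0 : ℝ) < N := Nat.cast_pos.2 hN
  obtain ⟨i, hi⟩ := exists_mem_cell hN x
  rw [cellStep_of_mem _ hi, abs_le]
  have h0 : 0 ≤ W.sampleDegree y i :=
    div_nonneg (Finset.sum_nonneg fun j _ => W.nonneg' _ _) hN'.le
  have h1 : W.sampleDegree y i ≤ 1 := by
    rw [sampleDegree, div_le_one hN']
    refine (Finset.sum_le_sum fun j _ => W.le_one' _ _).trans_eq ?_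
    simp
  have := W.degree_nonneg x
  have := W.degree_le_one x
  constructor <;> linarith

/-- The error is the integral over `v` of the difference `D` of two rows, so Jensen bounds its
square by `∫ D ^ 2`. Away from the breakpoints both coordinates move by at most `b`, whence `|D| ≤ 2
* L * b`; near them only `|D| ≤ 1` is available. -/
theorem IsPiecewiseLipschitz.sq_cellStep_sampleDegree_sub_degree_le
    (hW : W.IsPiecewiseLipschitz L K α) (hN : 0 < N) {b : ℝ} {y : Fin N → I}
    (hy1 : ∀ i, (y i : ℝ) < 1) (hy : ∀ i, ∀ u ∈ cell N i, |(y i : ℝ) - u| ≤ b)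
    {x : I} (hx1 : (x : ℝ) < 1) (hx : x ∉ nearPartition α b) :
    (cellStep N (W.sampleDegree y) x - W.degree x) ^ 2 ≤
      4 * L ^ 2 * b ^ 2 + (volume : Measure I).real (nearPartition α b) := by
  obtain ⟨i, hi⟩ := exists_mem_cell hN x
  have hL := hW.lipschitz_nonneg
  set D : I → ℝ := fun v => cellStep N (fun j => W (y i) (y j)) v - W x v with hD
  have hDmem : MemLp D 2 (volume : Measure I) := (memLp_cellStep hN _).sub
    (memLp_two_of_abs_le (W.measurable_right x) (W.abs_le_one x))
  have hDint : cellStep N (W.sampleDegree y) x - W.degree x = ∫ v, D v := by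
    rw [hD, integral_sub ((memLp_cellStep hN _).integrable one_le_two) (W.integrable_right x),
      integral_cellStep, cellStep_of_mem _ hi]
    rfl
  rw [hDint]
  refine (sq_integral_le_integral_sq hDmem).trans ?_
  have hms := measurableSet_nearPartition α b
  have hind : Integrable ((nearPartition α b).indicator fun _ => (1 : ℝ)) (volume : Measure I) :=
    (integrable_const _).indicator hms
  have hle : ∫ v, D v ^ 2 ≤
      ∫ v, (4 * L ^ 2 * b ^ 2 + (nearPartition α b).indicator (fun _ => (1 : ℝ)) v) := by
    refine integral_mono_ae hDmem.integrable_sq ((integrable_const _).add hind) ?_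
    have hne : ∀ᵐ v : I, v ≠ 1 := by simp [ae_iff]
    filter_upwards [hne] with v hv
    have hv1 : (v : ℝ) < 1 := lt_of_le_of_ne v.2.2 fun h => hv (Subtype.ext h)
    obtain ⟨j, hj⟩ := exists_mem_cell hN v
    simp only [hD, cellStep_of_mem _ hj]
    by_cases hvn : v ∈ nearPartition α b
    · rw [indicator_of_mem hvn]
      have : |W (y i) (y j) - W x v| ≤ 1 := abs_le.2
        ⟨by linarith [W.nonneg' (y i) (y j), W.le_one' x v],
          by linarith [W.nonneg' x v, W.le_one' (y i) (y j)]⟩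
      have := (sq_le_one_iff_abs_le_one _).2 this
      have : 0 ≤ 4 * L ^ 2 * b ^ 2 := by positivity
      linarith
    · rw [indicator_of_notMem hvn, add_zero]
      obtain ⟨k, hk1, hk2⟩ :=
        hW.exists_mem_Ico_of_notMem_nearPartition hx1 (hy1 i) (hy i x hi) hx
      obtain ⟨l, hl1, hl2⟩ :=
        hW.exists_mem_Ico_of_notMem_nearPartition hv1 (hy1 j) (hy j v hj) hvn
      have h := hW.lipschitz k l (y i) x (y j) v hk2 hk1 hl2 hl1
      have h' : |W (y i) (y j) - W x v| ≤ 2 * L * b := by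
        refine h.trans ?_
        have := mul_le_mul_of_nonneg_left (add_le_add (hy i x hi) (hy j v hj)) hL
        linarith
      have h2 := pow_le_pow_left₀ (abs_nonneg _) h' 2
      rw [sq_abs] at h2
      linarith
  refine hle.trans_eq ?_
  rw [integral_add (integrable_const _) hind, integral_indicator hms, setIntegral_const]
  simp

/-- The degree function of a piecewise Lipschitz graphon is approximated in `L²` by the normalized
degrees of a weighted graph sampled at points that are close to the uniform grid. -/
theorem IsPiecewiseLipschitz.l2Norm_cellStep_sampleDegree_sub_degree_le
    (hW : W.IsPiecewiseLipschitz L K α) (hN : 0 < N) {b : ℝ} (hb : 0 ≤ b)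
    (hKb : 2 * (K : ℝ) * b ≤ 1) {y : Fin N → I}
    (hy1 : ∀ i, (y i : ℝ) < 1) (hy : ∀ i, ∀ u ∈ cell N i, |(y i : ℝ) - u| ≤ b) :
    l2Norm (fun x => cellStep N (W.sampleDegree y) x - W.degree x) ≤
      2 * √((L ^ 2 - (K : ℝ) ^ 2) * b ^ 2 + K * b) := by
  set B := nearPartition α b with hB
  set m := (volume : Measure I).real B with hm
  have hms : MeasurableSet B := measurableSet_nearPartition α b
  have hm0 : 0 ≤ m := measureReal_nonneg
  have hm1 : m ≤ 2 * K * b := volume_real_nearPartition_le α hb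
  set C := 4 * L ^ 2 * b ^ 2 + m with hC
  have hmem : MemLp (fun x => cellStep N (W.sampleDegree y) x - W.degree x) 2
      (volume : Measure I) := (memLp_cellStep hN _).sub W.memLp_degree
  have hi1 : Integrable (Bᶜ.indicator fun _ => C) (volume : Measure I) :=
    (integrable_const _).indicator hms.compl
  have hi2 : Integrable (B.indicator fun _ => (1 : ℝ)) (volume : Measure I) :=
    (integrable_const _).indicator hms
  have hle : l2Norm (fun x => cellStep N (W.sampleDegree y) x - W.degree x) ^ 2 ≤
      C * (1 - m) + m := by
    rw [l2Norm_sq_eq hmem]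
    calc _ ≤ ∫ x, (Bᶜ.indicator (fun _ => C) x + B.indicator (fun _ => (1 : ℝ)) x) := by
          refine integral_mono_ae hmem.integrable_sq (hi1.add hi2) ?_
          have hne : ∀ᵐ v : I, v ≠ 1 := by simp [ae_iff]
          filter_upwards [hne] with x hx
          have hx1 : (x : ℝ) < 1 := lt_of_le_of_ne x.2.2 fun h => hx (Subtype.ext h)
          by_cases hxB : x ∈ B
          · rw [indicator_of_mem hxB, indicator_of_notMem (by simpa using hxB), zero_add]
            exact (sq_le_one_iff_abs_le_one _).2
              (W.abs_cellStep_sampleDegree_sub_degree_le hN y x)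
          · rw [indicator_of_notMem hxB, indicator_of_mem (by simpa using hxB), add_zero]
            exact hW.sq_cellStep_sampleDegree_sub_degree_le hN hy1 hy hx1 hxB
      _ = C * (1 - m) + m := by
          rw [integral_add hi1 hi2, integral_indicator hms, integral_indicator hms.compl,
            setIntegral_const, setIntegral_const, measureReal_compl hms, probReal_univ]
          simp only [smul_eq_mul, mul_one]
          rw [mul_comm]
  -- Apart from the Lipschitz term, the left side is `2 * m - m ^ 2`. This increases for `m ≤ 1`, so
  -- `m` may be replaced by `2 * K * b ≤ 1`; the square produces the term `-K ^ 2`.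
  have hA : C * (1 - m) + m ≤ 4 * ((L ^ 2 - (K : ℝ) ^ 2) * b ^ 2 + K * b) := by
    have h1 : 0 ≤ 4 * L ^ 2 * b ^ 2 * m := by positivity
    have h2 : 0 ≤ (2 * K * b - m) * (2 - m - 2 * K * b) :=
      mul_nonneg (by linarith) (by linarith)
    rw [hC]
    nlinarith
  have hsq := hle.trans hA
  -- The radicand is nonnegative because four times it bounds a square.
  have hnn : 0 ≤ (L ^ 2 - (K : ℝ) ^ 2) * b ^ 2 + K * b := by
    linarith [(sq_nonneg _).trans hsq]
  refine (pow_le_pow_iff_left₀ (l2Norm_nonneg _) (by positivity) two_ne_zero).1 ?_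
  rw [mul_pow, Real.sq_sqrt hnn]
  linarith

end Graphon

/-! ### From degrees to eigenvalues in `L²` -/

/-- If the normalized degrees of `g` are `φ`-close to the degree function of `W`, then so are the
normalized Laplacian eigenvalues, suitably permuted, up to an error controlled by the norm of the
integral operator. -/
theorem exists_perm_l2Norm_eigenvalueStep_sub_degree_le (W : Graphon) {N : ℕ} (hN : 0 < N)
    (g : SimpleGraph (Fin N)) {φ : ℝ}
    (hφ : l2Norm (fun x => cellStep N (fun i => vertexDegree g i / N) x - W.degree x) ≤ φ) :
    ∃ π : Equiv.Perm (Fin N), l2Norm (fun x => eigenvalueStep g π x - W.degree x) ≤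
      √((W.opNorm + φ) / N) + φ := by
  have hN' : (0 : ℝ) < N := Nat.cast_pos.2 hN
  obtain ⟨π, hπ⟩ := exists_perm_sum_sq_laplacianEigenvalue_sub_le g
  refine ⟨π, ?_⟩
  set c : Fin N → ℝ := fun i => vertexDegree g i / N with hc
  -- The mean normalized degree is the integral of the step function, hence at most its `L²` norm.
  have hdS : (∑ i, c i) / N ≤ W.opNorm + φ := by
    rw [← integral_cellStep]
    refine (le_abs_self _).trans ((abs_integral_le_l2Norm (memLp_cellStep hN c)).trans ?_)
    have h := l2Norm_add_le W.memLp_degree ((memLp_cellStep hN c).sub W.memLp_degree)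
    simp only [Pi.sub_apply, add_sub_cancel] at h
    exact h.trans (add_le_add W.l2Norm_degree_le_opNorm hφ)
  have hstep : eigenvalueStep g π = cellStep N (fun i => normalizedEigenvalue g (π i)) := rfl
  have hsq : l2Norm (fun x => eigenvalueStep g π x - cellStep N c x) ^ 2 ≤
      (W.opNorm + φ) / N := by
    simp only [hstep, cellStep_sub]
    rw [l2Norm_cellStep_sq hN]
    refine div_le_div_of_nonneg_right ?_ hN'.le
    refine le_trans ?_ hdS
    have h1 : ∑ i, (normalizedEigenvalue g (π i) - c i) ^ 2 =
        (∑ i, (laplacianEigenvalue g (π i) - vertexDegree g i) ^ 2) / N ^ 2 := by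
      rw [Finset.sum_div]
      refine Finset.sum_congr rfl fun i _ => ?_
      rw [normalizedEigenvalue, hc, ← sub_div, div_pow]
    rw [h1, hc, ← Finset.sum_div, div_div, ← sq]
    exact div_le_div_of_nonneg_right hπ (by positivity)
  have h := l2Norm_add_le
    ((memLp_cellStep hN fun i => normalizedEigenvalue g (π i)).sub (memLp_cellStep hN c))
    ((memLp_cellStep hN c).sub W.memLp_degree)
  simp only [Pi.sub_apply, sub_add_sub_cancel] at h
  exact h.trans (add_le_add (Real.le_sqrt_of_sq_le hsq) hφ)

/-! ### Order statistics of a uniform sample -/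

theorem measurable_orderStat {N : ℕ} (i : Fin N) :
    Measurable fun x : Fin N → I => orderStat x i := by
  let _ : MeasurableSpace (Equiv.Perm (Fin N)) := ⊤
  have : DiscreteMeasurableSpace (Equiv.Perm (Fin N)) := ⟨fun _ => trivial⟩
  have hsort : Measurable fun x : Fin N → I => Tuple.sort x := by
    refine measurable_to_countable' fun τ => ?_
    -- The sorting permutation takes finitely many values; each is characterized by monotonicity and
    -- by breaking ties in index order, both measurable conditions.
    have : (fun x : Fin N → I => Tuple.sort x) ⁻¹' {τ} =
        (⋂ i, ⋂ j, ⋂ _ : i ≤ j, {x | x (τ i) ≤ x (τ j)}) ∩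
          ⋂ i, ⋂ j, ⋂ _ : i < j, {x | ¬ x (τ i) = x (τ j) ∨ τ i < τ j} := by
      ext x
      simp only [mem_preimage, mem_singleton_iff, mem_inter_iff, mem_iInter, mem_ofPred_eq,
        ← imp_iff_not_or]
      rw [eq_comm, Tuple.eq_sort_iff]
      rfl
    rw [this]
    refine MeasurableSet.inter ?_ ?_ <;>
      refine MeasurableSet.iInter fun i => MeasurableSet.iInter fun j => MeasurableSet.iInter
        fun _ => ?_
    · exact measurableSet_le (measurable_pi_apply _) (measurable_pi_apply _)
    · exact (measurableSet_eq_fun (f := fun x : Fin N → I => x (τ i))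
        (measurable_pi_apply _) (measurable_pi_apply (τ j))).compl.union (MeasurableSet.const _)
  have h2 : Measurable fun q : (Fin N → I) × Equiv.Perm (Fin N) => q.1 (q.2 i) :=
    measurable_from_prod_countable_left fun τ => measurable_pi_apply (τ i)
  exact h2.comp (measurable_id.prodMk hsort)

theorem le_sum_indicator_of_lt_orderStat {N : ℕ} {x : Fin N → I} {i : Fin N} {t : ℝ}
    (h : t < orderStat x i) :
    (N : ℝ) - i ≤ ∑ j, {u : I | t < u}.indicator (fun _ => (1 : ℝ)) (x j) := by
  rw [← Equiv.sum_comp (Tuple.sort x)]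
  calc (N : ℝ) - i = ∑ j : Fin N, if j ∈ Finset.Ici i then (1 : ℝ) else 0 := by
        rw [Finset.sum_ite_mem, Finset.univ_inter]
        simp [Nat.cast_sub i.2.le]
    _ ≤ _ := by
        refine Finset.sum_le_sum fun j _ => ?_
        split_ifs with hj
        · rw [indicator_of_mem]
          have : orderStat x i ≤ x (Tuple.sort x j) := Tuple.monotone_sort x (Finset.mem_Ici.1 hj)
          exact h.trans_le this
        · exact indicator_nonneg (fun _ _ => zero_le_one) _

theorem le_sum_indicator_of_orderStat_lt {N : ℕ} {x : Fin N → I} {i : Fin N} {t : ℝ}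
    (h : orderStat x i < t) :
    (i : ℝ) + 1 ≤ ∑ j, {u : I | (u : ℝ) < t}.indicator (fun _ => (1 : ℝ)) (x j) := by
  rw [← Equiv.sum_comp (Tuple.sort x)]
  calc (i : ℝ) + 1 = ∑ j : Fin N, if j ∈ Finset.Iic i then (1 : ℝ) else 0 := by
        rw [Finset.sum_ite_mem, Finset.univ_inter]
        simp
    _ ≤ _ := by
        refine Finset.sum_le_sum fun j _ => ?_
        split_ifs with hj
        · rw [indicator_of_mem]
          have : x (Tuple.sort x j) ≤ orderStat x i := Tuple.monotone_sort x (Finset.mem_Iic.1 hj)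
          exact lt_of_le_of_lt (Subtype.coe_le_coe.2 this) h
        · exact indicator_nonneg (fun _ _ => zero_le_one) _

section UniformSample

variable {Ω : Type*} [MeasurableSpace Ω] {P : Measure Ω} [IsProbabilityMeasure P] {N : ℕ}
  {X : Fin N → Ω → I}

/-- **Hoeffding's inequality** for the number of points of a uniform sample in a set. -/
theorem measureReal_le_sum_indicator_sub_le (hm : ∀ i, Measurable (X i))
    (hu : ∀ i, P.map (X i) = (volume : Measure I)) (hi : iIndepFun X P) {S : Set I}
    (hS : MeasurableSet S) {δ : ℝ} (hδ : 0 ≤ δ) :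
    P.real {ω | N * δ ≤ ∑ j, S.indicator (fun _ => (1 : ℝ)) (X j ω) -
      N * (volume : Measure I).real S} ≤ Real.exp (-(2 * N * δ ^ 2)) := by
  set F : I → ℝ := fun u => S.indicator (fun _ => (1 : ℝ)) u - (volume : Measure I).real S with hF
  have hFm : Measurable F := (measurable_const.indicator hS).sub_const _
  have hindep : iIndepFun (fun j ω => F (X j ω)) P := hi.comp (fun _ => F) fun _ => hFm
  have hsub : ∀ j ∈ Finset.univ,
      HasSubgaussianMGF (fun ω => F (X j ω)) ((‖(1 : ℝ) - 0‖₊ / 2) ^ 2) P := by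
    intro j _
    have h := hasSubgaussianMGF_of_mem_Icc (μ := P) (a := 0) (b := 1)
      (X := fun ω => S.indicator (fun _ => (1 : ℝ)) (X j ω))
      ((measurable_const.indicator hS).comp (hm j)).aemeasurable
      (Filter.Eventually.of_forall fun ω => by by_cases h : X j ω ∈ S <;> simp [h])
    have hint : ∫ ω, S.indicator (fun _ => (1 : ℝ)) (X j ω) ∂P = (volume : Measure I).real S := by
      rw [← integral_map (hm j).aemeasurable
        (measurable_const.indicator hS).aestronglyMeasurable, hu j, integral_indicator hS,
        setIntegral_const, smul_eq_mul, mul_one]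
    rwa [hint] at h
  have h := HasSubgaussianMGF.measure_sum_ge_le_of_iIndepFun hindep hsub
    (ε := N * δ) (by positivity)
  have hset : ∀ ω, ∑ j, F (X j ω) = ∑ j, S.indicator (fun _ => (1 : ℝ)) (X j ω) -
      N * (volume : Measure I).real S := fun ω => by
    rw [hF, Finset.sum_sub_distrib]; simp
  simp only [hset] at h
  refine h.trans (Real.exp_le_exp.2 (le_of_eq ?_))
  rcases Nat.eq_zero_or_pos N with rfl | hN
  · simp
  · have : (N : ℝ) ≠ 0 := Nat.cast_ne_zero.2 hN.ne'
    simp only [sub_zero, nnnorm_one, Finset.sum_const, Finset.card_univ, Fintype.card_fin]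
    push_cast
    rw [nsmul_eq_mul]
    field_simp

theorem volume_real_setOf_lt_coe {t : ℝ} (h0 : 0 ≤ t) (h1 : t ≤ 1) :
    (volume : Measure I).real {u : I | t < u} = 1 - t := by
  have : {u : I | t < u} = Ioi (⟨t, h0, h1⟩ : I) := rfl
  rw [this, measureReal_def, unitInterval.volume_Ioi, ENNReal.toReal_ofReal (by simpa using h1)]

theorem volume_real_setOf_coe_lt {t : ℝ} (h0 : 0 ≤ t) (h1 : t ≤ 1) :
    (volume : Measure I).real {u : I | (u : ℝ) < t} = t := by
  have : {u : I | (u : ℝ) < t} = Iio (⟨t, h0, h1⟩ : I) := rfl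
  rw [this, measureReal_def, unitInterval.volume_Iio, ENNReal.toReal_ofReal h0]

/-- The order statistics of a uniform sample are uniformly close to the uniform grid. -/
theorem measure_orderStat_far_le (hm : ∀ i, Measurable (X i))
    (hu : ∀ i, P.map (X i) = (volume : Measure I)) (hi : iIndepFun X P) {δ : ℝ} (hδ : 0 ≤ δ) :
    P {ω | ¬ ∀ i, ((orderStat (fun j => X j ω) i : I) : ℝ) < 1 ∧
      ∀ u ∈ cell N i, |((orderStat (fun j => X j ω) i : I) : ℝ) - u| ≤ 1 / N + δ} ≤
      ENNReal.ofReal (2 * N * Real.exp (-(2 * N * δ ^ 2))) := by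
  set E : Set I → Set Ω := fun S => {ω | N * δ ≤ ∑ j, S.indicator (fun _ => (1 : ℝ)) (X j ω) -
      N * (volume : Measure I).real S} with hE
  set S₁ : Fin N → Set I := fun i => {u : I | ((i : ℝ) + 1) / N + δ < u} with hS₁
  set S₂ : Fin N → Set I := fun i => {u : I | (u : ℝ) < (i : ℝ) / N - δ} with hS₂
  have hbound : ∀ S, MeasurableSet S →
      P (E S) ≤ ENNReal.ofReal (Real.exp (-(2 * N * δ ^ 2))) := fun S hS => by
    rw [← ENNReal.ofReal_toReal (measure_ne_top P (E S))]
    exact ENNReal.ofReal_le_ofReal (measureReal_le_sum_indicator_sub_le hm hu hi hS hδ)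
  have hcoe : Measurable fun u : I => (u : ℝ) := measurable_subtype_coe
  -- The half-open intervals of the Lipschitz condition miss the point 1, so samples there must be
  -- discarded.
  have hone : ∀ j, P {ω | X j ω = 1} = 0 := fun j => by
    have : {ω | X j ω = 1} = X j ⁻¹' {1} := rfl
    rw [this, ← Measure.map_apply (hm j) (measurableSet_singleton _), hu j, measure_singleton]
  have hsub : {ω | ¬ ∀ i, ((orderStat (fun j => X j ω) i : I) : ℝ) < 1 ∧
      ∀ u ∈ cell N i, |((orderStat (fun j => X j ω) i : I) : ℝ) - u| ≤ 1 / N + δ} ⊆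
      (⋃ j, {ω | X j ω = 1}) ∪ ((⋃ i, E (S₁ i)) ∪ ⋃ i, E (S₂ i)) := by
    intro ω hω
    by_contra hcon
    simp only [mem_union, mem_iUnion, not_or, not_exists] at hcon
    obtain ⟨h1, h2, h3⟩ := hcon
    refine hω fun i => ?_
    have hN : (0 : ℝ) < N := Nat.cast_pos.2 i.pos
    have hiN : (i : ℝ) + 1 ≤ N := by exact_mod_cast i.2
    have hup : ((orderStat (fun j => X j ω) i : I) : ℝ) ≤ ((i : ℝ) + 1) / N + δ := by
      by_contra! h
      refine h2 i ?_
      -- At least `N - i` points exceed the threshold, where `N - i - 1 - N * δ` are expected: an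
      -- excess of more than `N * δ`.
      have hs := le_sum_indicator_of_lt_orderStat h
      have ht1 : ((i : ℝ) + 1) / N + δ ≤ 1 :=
        h.le.trans (orderStat (fun j => X j ω) i).2.2
      have hv := volume_real_setOf_lt_coe (by positivity) ht1
      simp only [hE, hS₁, mem_ofPred_eq, hv]
      have : (N : ℝ) * (1 - (((i : ℝ) + 1) / N + δ)) = N - (i + 1) - N * δ := by
        field_simp; ring
      rw [this]
      linarith
    have hlo : (i : ℝ) / N - δ ≤ ((orderStat (fun j => X j ω) i : I) : ℝ) := by
      by_contra! h
      refine h3 i ?_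
      have hs := le_sum_indicator_of_orderStat_lt h
      have ht0 : 0 ≤ (i : ℝ) / N - δ := (orderStat (fun j => X j ω) i).2.1.trans h.le
      have ht1 : (i : ℝ) / N - δ ≤ 1 := by
        have : (i : ℝ) / N ≤ 1 := by rw [div_le_one hN]; linarith
        linarith
      have hv := volume_real_setOf_coe_lt ht0 ht1
      simp only [hE, hS₂, mem_ofPred_eq, hv]
      have : (N : ℝ) * ((i : ℝ) / N - δ) = i - N * δ := by field_simp
      rw [this]
      linarith
    refine ⟨lt_of_le_of_ne (orderStat (fun j => X j ω) i).2.2 fun h => h1 _ (Subtype.ext h),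
      fun u hu' => abs_le.2 ?_⟩
    have hc := mem_cell_le hu'
    rw [add_div] at hc hup
    constructor <;> linarith
  have h₁ : P (⋃ i, E (S₁ i)) ≤ N * ENNReal.ofReal (Real.exp (-(2 * N * δ ^ 2))) := by
    refine (measure_iUnion_fintype_le _ _).trans ((Finset.sum_le_sum fun i _ =>
      hbound (S₁ i) (measurableSet_lt measurable_const hcoe)).trans_eq ?_)
    simp
  have h₂ : P (⋃ i, E (S₂ i)) ≤ N * ENNReal.ofReal (Real.exp (-(2 * N * δ ^ 2))) := by
    refine (measure_iUnion_fintype_le _ _).trans ((Finset.sum_le_sum fun i _ =>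
      hbound (S₂ i) (measurableSet_lt hcoe measurable_const)).trans_eq ?_)
    simp
  have h₀ : P (⋃ j, {ω | X j ω = 1}) = 0 := measure_iUnion_null hone
  calc _ ≤ _ := measure_mono hsub
    _ ≤ 0 + (N * ENNReal.ofReal (Real.exp (-(2 * N * δ ^ 2))) +
        N * ENNReal.ofReal (Real.exp (-(2 * N * δ ^ 2)))) :=
      (measure_union_le _ _).trans
        (add_le_add h₀.le ((measure_union_le _ _).trans (add_le_add h₁ h₂)))
    _ = _ := by
      rw [zero_add, ← two_mul, ENNReal.ofReal_mul (by positivity), ENNReal.ofReal_mul (by norm_num)]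
      simp [mul_assoc]

end UniformSample

/-! ### Concentration of degrees for fixed edge probabilities -/

/-- A centred Bernoulli variable is sub-Gaussian. -/
theorem bernoulli_exp_le {p : ℝ} (h0 : 0 ≤ p) (h1 : p ≤ 1) (s : ℝ) :
    p * Real.exp (s * (1 - p)) + (1 - p) * Real.exp (s * (0 - p)) ≤ Real.exp (s ^ 2 / 2) := by
  -- The chord of the exponential over `[-1, 1]`. Averaging over a centred variable kills the linear
  -- part and leaves `cosh s`.
  have key : ∀ x : ℝ, -1 ≤ x → x ≤ 1 →
      Real.exp (s * x) ≤ (1 + x) / 2 * Real.exp s + (1 - x) / 2 * Real.exp (-s) := by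
    intro x hx hx'
    have h := convexOn_exp.2 (mem_univ s) (mem_univ (-s))
      (show 0 ≤ (1 + x) / 2 by linarith) (show 0 ≤ (1 - x) / 2 by linarith) (by ring)
    simp only [smul_eq_mul] at h
    rwa [show (1 + x) / 2 * s + (1 - x) / 2 * -s = s * x by ring] at h
  have ha := mul_le_mul_of_nonneg_left (key (1 - p) (by linarith) (by linarith)) h0
  have hb := mul_le_mul_of_nonneg_left (key (0 - p) (by linarith) (by linarith))
    (sub_nonneg.2 h1)
  have hc := Real.cosh_le_exp_half_sq s
  rw [Real.cosh_eq] at hc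
  linarith

section GraphSums

variable {N : ℕ}

open Classical in
/-- Expanding a product over pairs of vertices bounds the corresponding sum over graphs. -/
theorem sum_simpleGraph_prod_ite_le {a b : Fin N → Fin N → ℝ} (ha : ∀ i j, 0 ≤ a i j)
    (hb : ∀ i j, 0 ≤ b i j) :
    ∑ g : SimpleGraph (Fin N), ∏ i, ∏ j ∈ Finset.Ioi i, (if g.Adj i j then a i j else b i j) ≤
      ∏ i, ∏ j ∈ Finset.Ioi i, (a i j + b i j) := by
  set s : Finset (Σ _ : Fin N, Fin N) := Finset.univ.sigma fun i => Finset.Ioi i with hs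
  set F : Finset (Σ _ : Fin N, Fin N) → ℝ := fun t =>
    (∏ e ∈ t, a e.1 e.2) * ∏ e ∈ s \ t, b e.1 e.2 with hF
  set T : SimpleGraph (Fin N) → Finset (Σ _ : Fin N, Fin N) := fun g =>
    s.filter fun e => g.Adj e.1 e.2 with hT
  have hinj : Function.Injective T := by
    intro g g' h
    have hlt : ∀ i j, i < j → (g.Adj i j ↔ g'.Adj i j) := by
      intro i j hij
      have h' := Finset.ext_iff.1 h ⟨i, j⟩
      simpa [hT, hs, hij] using h'
    ext i j
    rcases lt_trichotomy i j with hij | rfl | hij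
    · exact hlt i j hij
    · simp
    · rw [g.adj_comm, g'.adj_comm]; exact hlt j i hij
  have hl : ∀ g : SimpleGraph (Fin N),
      ∏ i, ∏ j ∈ Finset.Ioi i, (if g.Adj i j then a i j else b i j) = F (T g) := by
    intro g
    rw [Finset.prod_sigma', Finset.prod_ite, Finset.filter_not]
  have hr : ∏ i, ∏ j ∈ Finset.Ioi i, (a i j + b i j) = ∑ t ∈ s.powerset, F t := by
    rw [Finset.prod_sigma', Finset.prod_add]
  -- A graph is determined by its set of pairs `i < j`. Injectivity and nonnegative terms suffice
  -- for the inequality.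
  rw [hr, Finset.sum_congr rfl fun g _ => hl g, ← Finset.sum_image (f := F) hinj.injOn]
  refine Finset.sum_le_sum_of_subset_of_nonneg ?_ fun t _ _ =>
    mul_nonneg (Finset.prod_nonneg fun e _ => ha _ _) (Finset.prod_nonneg fun e _ => hb _ _)
  intro t ht
  obtain ⟨g, -, rfl⟩ := Finset.mem_image.1 ht
  exact Finset.mem_powerset.2 (Finset.filter_subset _ _)

/-- A symmetric function on pairs of vertices, summed over the pairs containing `v`. -/
theorem sum_Ioi_ite_eq_sum_ne {h : Fin N → Fin N → ℝ} (hsymm : ∀ i j, h i j = h j i)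
    (v : Fin N) :
    ∑ i, ∑ j ∈ Finset.Ioi i, (if i = v ∨ j = v then (1 : ℝ) else 0) * h i j =
      ∑ j, if j = v then 0 else h v j := by
  have h1 : ∀ i, ∑ j ∈ Finset.Ioi i, (if i = v ∨ j = v then (1 : ℝ) else 0) * h i j =
      (if i = v then ∑ j ∈ Finset.Ioi v, h v j else 0) + if i < v then h v i else 0 := by
    intro i
    have h2 : ∀ j ∈ Finset.Ioi i, (if i = v ∨ j = v then (1 : ℝ) else 0) * h i j =
        (if i = v then h v j else 0) + if j = v then h v i else 0 := by
      intro j hj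
      have hij : i < j := Finset.mem_Ioi.1 hj
      by_cases hi : i = v
      · subst hi; simp [hij.ne']
      · by_cases hj' : j = v
        · subst hj'; simp [hi, hsymm i j]
        · simp [hi, hj']
    rw [Finset.sum_congr rfl h2, Finset.sum_add_distrib]
    congr 1
    · split_ifs with hi
      · rw [hi]
      · simp
    · rw [Finset.sum_ite_eq']
      simp
  rw [Finset.sum_congr rfl fun i _ => h1 i, Finset.sum_add_distrib, Finset.sum_ite_eq']
  simp only [Finset.mem_univ, if_true]
  have h3 : ∑ j ∈ Finset.Ioi v, h v j = ∑ j, if v < j then h v j else 0 := by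
    rw [← Finset.sum_filter]
    refine Finset.sum_congr ?_ fun _ _ => rfl
    ext j; simp
  rw [h3, ← Finset.sum_add_distrib]
  refine Finset.sum_congr rfl fun j _ => ?_
  rcases lt_trichotomy j v with hj | rfl | hj
  · simp [hj, hj.ne, hj.not_gt]
  · simp
  · simp [hj, hj.ne', hj.not_gt]

open Classical in
/-- The centred degree of the vertex `v` in a graph with edge probabilities `p`. -/
def degreeDeviation (p : Fin N → Fin N → ℝ) (g : SimpleGraph (Fin N)) (v : Fin N) : ℝ :=
  ∑ j, if j = v then 0 else (if g.Adj v j then 1 else 0) - p v j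

open Classical in
-- The edges are independent, so the moment generating function factors over pairs. Only pairs
-- containing `v`, fewer than `N` of them, contribute, each at most `exp (s ^ 2 / 2)`.
theorem sum_prod_mul_exp_degreeDeviation_le {p : Fin N → Fin N → ℝ}
    (hsymm : ∀ i j, p i j = p j i) (h0 : ∀ i j, 0 ≤ p i j) (h1 : ∀ i j, p i j ≤ 1)
    (v : Fin N) (s : ℝ) :
    ∑ g : SimpleGraph (Fin N), (∏ i, ∏ j ∈ Finset.Ioi i, if g.Adj i j then p i j else 1 - p i j) *
      Real.exp (s * degreeDeviation p g v) ≤ Real.exp (N * (s ^ 2 / 2)) := by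
  set w : Fin N → Fin N → ℝ := fun i j => if i = v ∨ j = v then 1 else 0 with hw
  have hw2 : ∀ i j, w i j ^ 2 = w i j := fun i j => by
    simp only [hw]; split_ifs <;> norm_num
  have hdev : ∀ g : SimpleGraph (Fin N), Real.exp (s * degreeDeviation p g v) =
      ∏ i, ∏ j ∈ Finset.Ioi i,
        Real.exp (s * w i j * ((if g.Adj i j then 1 else 0) - p i j)) := by
    intro g
    have := sum_Ioi_ite_eq_sum_ne (h := fun i j => (if g.Adj i j then 1 else 0) - p i j)
      (fun i j => by rw [hsymm i j]; simp only [g.adj_comm]) v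
    rw [degreeDeviation, ← this, Finset.mul_sum, Real.exp_sum]
    refine Finset.prod_congr rfl fun i _ => ?_
    rw [Finset.mul_sum, Real.exp_sum]
    refine Finset.prod_congr rfl fun j _ => ?_
    rw [← mul_assoc]
  have hterm : ∀ g : SimpleGraph (Fin N),
      (∏ i, ∏ j ∈ Finset.Ioi i, if g.Adj i j then p i j else 1 - p i j) *
        Real.exp (s * degreeDeviation p g v) =
      ∏ i, ∏ j ∈ Finset.Ioi i, if g.Adj i j then p i j * Real.exp (s * w i j * (1 - p i j))
        else (1 - p i j) * Real.exp (s * w i j * (0 - p i j)) := by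
    intro g
    rw [hdev, ← Finset.prod_mul_distrib]
    refine Finset.prod_congr rfl fun i _ => ?_
    rw [← Finset.prod_mul_distrib]
    refine Finset.prod_congr rfl fun j _ => ?_
    split_ifs <;> rfl
  rw [Finset.sum_congr rfl fun g _ => hterm g]
  refine (sum_simpleGraph_prod_ite_le
    (fun i j => mul_nonneg (h0 i j) (Real.exp_nonneg _))
    fun i j => mul_nonneg (sub_nonneg.2 (h1 i j)) (Real.exp_nonneg _)).trans ?_
  have hnn : ∀ i j, 0 ≤ p i j * Real.exp (s * w i j * (1 - p i j)) +
      (1 - p i j) * Real.exp (s * w i j * (0 - p i j)) := fun i j =>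
    add_nonneg (mul_nonneg (h0 i j) (Real.exp_nonneg _))
      (mul_nonneg (sub_nonneg.2 (h1 i j)) (Real.exp_nonneg _))
  calc _ ≤ ∏ i, ∏ j ∈ Finset.Ioi i, Real.exp (w i j * (s ^ 2 / 2)) := by
        refine Finset.prod_le_prod (fun i _ => Finset.prod_nonneg fun j _ => hnn i j)
          fun i _ => Finset.prod_le_prod (fun j _ => hnn i j) fun j _ => ?_
        refine (bernoulli_exp_le (h0 i j) (h1 i j) (s * w i j)).trans_eq ?_
        rw [mul_pow, hw2]
        congr 1; ring
    _ = Real.exp (∑ j, if j = v then 0 else s ^ 2 / 2) := by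
        rw [← sum_Ioi_ite_eq_sum_ne (h := fun _ _ => s ^ 2 / 2) (fun _ _ => rfl) v, Real.exp_sum]
        refine Finset.prod_congr rfl fun i _ => ?_
        rw [Real.exp_sum]
    _ ≤ _ := by
        refine Real.exp_le_exp.2 ?_
        calc _ ≤ ∑ _j : Fin N, s ^ 2 / 2 := Finset.sum_le_sum fun j _ => by
              split_ifs
              · positivity
              · exact le_rfl
          _ = _ := by simp

open Classical in
-- Chernoff's method with `s = ±τ`, which minimizes `N * s ^ 2 / 2 - N * τ * |s|`; the two signs
-- give the factor 2.
theorem sum_prod_mul_ite_le_degreeDeviation_le {p : Fin N → Fin N → ℝ}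
    (hsymm : ∀ i j, p i j = p j i) (h0 : ∀ i j, 0 ≤ p i j) (h1 : ∀ i j, p i j ≤ 1)
    (v : Fin N) {τ : ℝ} (hτ : 0 ≤ τ) :
    ∑ g : SimpleGraph (Fin N), (∏ i, ∏ j ∈ Finset.Ioi i, if g.Adj i j then p i j else 1 - p i j) *
      (if N * τ ≤ |degreeDeviation p g v| then 1 else 0) ≤
      2 * Real.exp (-(N * τ ^ 2 / 2)) := by
  have hnn : ∀ g : SimpleGraph (Fin N),
      0 ≤ ∏ i, ∏ j ∈ Finset.Ioi i, if g.Adj i j then p i j else 1 - p i j := fun g =>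
    Finset.prod_nonneg fun i _ => Finset.prod_nonneg fun j _ => by
      split_ifs
      · exact h0 i j
      · exact sub_nonneg.2 (h1 i j)
  set c := Real.exp (-(N * τ ^ 2)) with hc
  have hpt : ∀ g : SimpleGraph (Fin N), (if N * τ ≤ |degreeDeviation p g v| then (1 : ℝ) else 0) ≤
      c * Real.exp (τ * degreeDeviation p g v) + c * Real.exp (-τ * degreeDeviation p g v) := by
    intro g
    split_ifs with h
    · rcases le_abs.1 h with h | h
      · refine le_add_of_le_of_nonneg ?_ (by positivity)
        rw [hc, ← Real.exp_add, Real.one_le_exp_iff]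
        nlinarith [mul_le_mul_of_nonneg_left h hτ]
      · refine le_add_of_nonneg_of_le (by positivity) ?_
        rw [hc, ← Real.exp_add, Real.one_le_exp_iff]
        nlinarith [mul_le_mul_of_nonneg_left h hτ]
    · positivity
  have ha := sum_prod_mul_exp_degreeDeviation_le hsymm h0 h1 v τ
  have hb := sum_prod_mul_exp_degreeDeviation_le hsymm h0 h1 v (-τ)
  rw [neg_sq] at hb
  have hc' : c * Real.exp (N * (τ ^ 2 / 2)) = Real.exp (-(N * τ ^ 2 / 2)) := by
    rw [hc, ← Real.exp_add]; congr 1; ring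
  calc _ ≤ ∑ g : SimpleGraph (Fin N),
        (∏ i, ∏ j ∈ Finset.Ioi i, if g.Adj i j then p i j else 1 - p i j) *
        (c * Real.exp (τ * degreeDeviation p g v) + c * Real.exp (-τ * degreeDeviation p g v)) :=
        Finset.sum_le_sum fun g _ => mul_le_mul_of_nonneg_left (hpt g) (hnn g)
    _ = c * (∑ g : SimpleGraph (Fin N),
          (∏ i, ∏ j ∈ Finset.Ioi i, if g.Adj i j then p i j else 1 - p i j) *
            Real.exp (τ * degreeDeviation p g v)) +
        c * ∑ g : SimpleGraph (Fin N),
          (∏ i, ∏ j ∈ Finset.Ioi i, if g.Adj i j then p i j else 1 - p i j) *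
            Real.exp (-τ * degreeDeviation p g v) := by
        rw [Finset.mul_sum, Finset.mul_sum, ← Finset.sum_add_distrib]
        exact Finset.sum_congr rfl fun g _ => by ring
    _ ≤ c * Real.exp (N * (τ ^ 2 / 2)) + c * Real.exp (N * (τ ^ 2 / 2)) := by gcongr
    _ = _ := by rw [hc']; ring

end GraphSums

/-! ### Concentration of degrees in the sampled graph -/

section SampledGraph

variable {N : ℕ} (W : Graphon)

/-- The edge probabilities of the random graph sampled from `W`, given the sample `x`. -/
def edgeProb (x : Fin N → I) (i j : Fin N) : ℝ := W (orderStat x i) (orderStat x j)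

theorem measurable_edgeProb (i j : Fin N) : Measurable fun x : Fin N → I => edgeProb W x i j :=
  W.measurable'.comp ((measurable_orderStat i).prodMk (measurable_orderStat j))

theorem measurable_degreeDeviation_edgeProb (g : SimpleGraph (Fin N)) (v : Fin N) :
    Measurable fun x : Fin N → I => degreeDeviation (edgeProb W x) g v := by
  refine Finset.measurable_fun_sum _ fun j _ => ?_
  by_cases h : j = v
  · simp only [h, if_true, measurable_const]
  · simp only [h, if_false]
    exact measurable_const.sub (measurable_edgeProb W v j)

theorem measurable_graphProb (g : SimpleGraph (Fin N)) :
    Measurable fun x : Fin N → I => graphProb W x g := by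
  refine Finset.measurable_fun_prod _ fun i _ => Finset.measurable_fun_prod _ fun j _ => ?_
  by_cases h : g.Adj i j
  · simp only [h, if_true]
    exact measurable_edgeProb W i j
  · simp only [h, if_false]
    exact measurable_const.sub (measurable_edgeProb W i j)

theorem graphProb_nonneg (x : Fin N → I) (g : SimpleGraph (Fin N)) : 0 ≤ graphProb W x g :=
  Finset.prod_nonneg fun i _ => Finset.prod_nonneg fun j _ => by
    split_ifs
    · exact W.nonneg' _ _
    · exact sub_nonneg.2 (W.le_one' _ _)

/-- Concentration of a vertex degree of a sampled graph around its conditional mean. -/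
theorem IsSampledGraph.measure_le_abs_degreeDeviation_le {Ω : Type*} [MeasurableSpace Ω]
    {P : Measure Ω} [IsProbabilityMeasure P] {W : Graphon} {X : Fin N → Ω → I}
    {G : Ω → SimpleGraph (Fin N)} (hG : IsSampledGraph P W X G) (v : Fin N) {τ : ℝ}
    (hτ : 0 ≤ τ) :
    P {ω | N * τ ≤ |degreeDeviation (edgeProb W fun i => X i ω) (G ω) v|} ≤
      ENNReal.ofReal (2 * Real.exp (-(N * τ ^ 2 / 2))) := by
  classical
  have hX : Measurable fun ω i => X i ω := measurable_pi_lambda _ hG.measurable_latent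
  set B : SimpleGraph (Fin N) → Set (Fin N → I) := fun g =>
    {x | N * τ ≤ |degreeDeviation (edgeProb W x) g v|} with hB
  have hBm : ∀ g, MeasurableSet (B g) := fun g =>
    measurableSet_le measurable_const
      (continuous_abs.measurable.comp (measurable_degreeDeviation_edgeProb W g v))
  have hsub : {ω | N * τ ≤ |degreeDeviation (edgeProb W fun i => X i ω) (G ω) v|} ⊆
      ⋃ g, ({ω | (fun i => X i ω) ∈ B g} ∩ {ω | G ω = g}) :=
    fun ω hω => mem_iUnion.2 ⟨G ω, hω, rfl⟩
  have hXB : ∀ g, MeasurableSet {ω | (fun i => X i ω) ∈ B g} := fun g => hX (hBm g)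
  have hmeas : ∀ g, Measurable fun ω => ENNReal.ofReal (graphProb W (fun i => X i ω) g) :=
    fun g => ENNReal.measurable_ofReal.comp ((measurable_graphProb W g).comp hX)
  -- Split by the finitely many values of `G`, so that `cond_law` applies with a different event for
  -- each graph; exchanging sum and integral leaves the fixed-sample bound under the integral.
  calc _ ≤ ∑ g, P ({ω | (fun i => X i ω) ∈ B g} ∩ {ω | G ω = g}) :=
        (measure_mono hsub).trans (measure_iUnion_fintype_le _ _)
    _ = ∑ g, ∫⁻ ω, {ω | (fun i => X i ω) ∈ B g}.indicator
          (fun ω => ENNReal.ofReal (graphProb W (fun i => X i ω) g)) ω ∂P := by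
        refine Finset.sum_congr rfl fun g _ => ?_
        rw [hG.cond_law g (B g) (hBm g), lintegral_indicator (hXB g)]
    _ = ∫⁻ ω, ∑ g, {ω | (fun i => X i ω) ∈ B g}.indicator
          (fun ω => ENNReal.ofReal (graphProb W (fun i => X i ω) g)) ω ∂P :=
        (lintegral_finsetSum _ fun g _ => (hmeas g).indicator (hXB g)).symm
    _ ≤ ∫⁻ _, ENNReal.ofReal (2 * Real.exp (-(N * τ ^ 2 / 2))) ∂P := by
        refine lintegral_mono fun ω => ?_
        have h : ∑ g, graphProb W (fun i => X i ω) g *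
            (if N * τ ≤ |degreeDeviation (edgeProb W fun i => X i ω) g v| then 1 else 0) ≤
            2 * Real.exp (-(N * τ ^ 2 / 2)) := sum_prod_mul_ite_le_degreeDeviation_le
          (p := edgeProb W fun i => X i ω)
          (fun i j => W.symm' _ _) (fun i j => W.nonneg' _ _) (fun i j => W.le_one' _ _) v hτ
        refine le_trans (le_of_eq ?_) (ENNReal.ofReal_le_ofReal h)
        rw [ENNReal.ofReal_sum_of_nonneg fun g _ => mul_nonneg (graphProb_nonneg W _ g)
          (by split_ifs <;> norm_num)]
        refine Finset.sum_congr rfl fun g _ => ?_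
        by_cases hg : (fun i => X i ω) ∈ B g
        · have hg' : N * τ ≤ |degreeDeviation (edgeProb W fun i => X i ω) g v| := hg
          rw [indicator_of_mem (by exact hg), if_pos hg', mul_one]
        · have hg' : ¬ N * τ ≤ |degreeDeviation (edgeProb W fun i => X i ω) g v| := hg
          rw [indicator_of_notMem (by exact hg), if_neg hg', mul_zero, ENNReal.ofReal_zero]
    _ = _ := by simp

end SampledGraph

/-! ### Numerical estimates for the rates -/

section Rates

variable {ν : ℝ} {N : ℕ}

theorem log_two_mul_div (hν : 0 < ν) (hN : 0 < N) :
    Real.log (2 * N / ν) = Real.log 2 + Real.log (N / ν) := by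
  have : (0 : ℝ) < N := Nat.cast_pos.2 hN
  rw [mul_div_assoc, Real.log_mul two_ne_zero (by positivity)]

theorem one_le_log_div (hν : 0 < ν) (hν1 : ν < Real.exp (-1)) (hN : 0 < N) :
    1 ≤ Real.log (N / ν) := by
  have hN' : (1 : ℝ) ≤ N := Nat.one_le_cast.2 hN
  rw [Real.log_div (by positivity) hν.ne']
  have h1 := Real.log_lt_log hν hν1
  rw [Real.log_exp] at h1
  have h2 := Real.log_nonneg hN'
  linarith

theorem exp_neg_log_two_mul_div (hν : 0 < ν) (hN : 0 < N) :
    2 * N * Real.exp (-Real.log (2 * N / ν)) = ν := by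
  have : (0 : ℝ) < N := Nat.cast_pos.2 hN
  rw [Real.exp_neg, Real.exp_log (by positivity)]
  field_simp

/-- The exponent is at least `8 * log (N / ν)` since `16 * N / (N + 1) ≥ 8`, while `log 2 + log (N /
ν)` would suffice. -/
theorem two_mul_exp_orderStat_le (hν : 0 < ν) (hν1 : ν < Real.exp (-1)) (hN : 0 < N) :
    2 * N * Real.exp (-(2 * N * √(8 * Real.log (N / ν) / (N + 1)) ^ 2)) ≤ ν := by
  have hN' : (1 : ℝ) ≤ N := Nat.one_le_cast.2 hN
  have hl := one_le_log_div hν hν1 hN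
  have h2 := Real.log_two_lt_d9
  rw [Real.sq_sqrt (by positivity)]
  refine le_of_le_of_eq ?_ (exp_neg_log_two_mul_div hν hN)
  refine mul_le_mul_of_nonneg_left (Real.exp_le_exp.2 (neg_le_neg ?_)) (by positivity)
  rw [log_two_mul_div hν hN, ← mul_div_assoc, le_div_iff₀ (by positivity)]
  nlinarith

/-- The fluctuation of the degrees and the missing diagonal are absorbed in the first term of
`phiRate`. -/
theorem sqrt_add_one_div_le (hν : 0 < ν) (hν1 : ν < Real.exp (-1)) (hN : 2 ≤ N) :
    √(2 * Real.log (2 * N / ν) / N) + 1 / N ≤ √(4 * Real.log (2 * N / ν) / N) := by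
  have hN' : (2 : ℝ) ≤ N := by exact_mod_cast hN
  have hN0 : (0 : ℝ) < N := by linarith
  have hl := one_le_log_div hν hν1 (by omega : 0 < N)
  have h2 := Real.log_two_gt_d9
  set M := Real.log (2 * N / ν) with hM
  have hM1 : 1.6 ≤ M := by rw [hM, log_two_mul_div hν (by omega)]; norm_num at *; linarith
  have hMN : 0 ≤ M / N := by positivity
  set a := √(M / N) with ha
  have ha0 : 0 ≤ a := Real.sqrt_nonneg _
  have hasq : a ^ 2 = M / N := Real.sq_sqrt hMN
  have h4 : √(4 * M / N) = 2 * a := by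
    rw [Real.sqrt_eq_iff_eq_sq (by positivity) (by positivity), mul_pow, hasq]; ring
  -- The budget `2 * a` is split as `1.42 + 0.58`, with `1.42 > √2`; the second share covers `1 / N`
  -- because `M * N ≥ 3.2`.
  have h2' : √(2 * M / N) ≤ 1.42 * a := by
    refine Real.sqrt_le_iff.2 ⟨by positivity, ?_⟩
    rw [mul_pow, hasq, mul_div_assoc]
    nlinarith
  have h1 : 1 / (N : ℝ) ≤ 0.58 * a := by
    refine (pow_le_pow_iff_left₀ (by positivity) (by positivity) two_ne_zero).1 ?_
    rw [mul_pow, hasq, div_pow, one_pow, mul_div_assoc', div_le_div_iff₀ (by positivity) hN0]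
    nlinarith [mul_le_mul hM1 hN' (by norm_num) (by linarith)]
  rw [h4]
  linarith

theorem sqrt_div_le_rpow_mul_sqrt {x : ℝ} (hN : 0 < N) :
    √(x / N) ≤ (2 / (N : ℝ)) ^ (1 / 4 : ℝ) * √x := by
  have hN' : (1 : ℝ) ≤ N := Nat.one_le_cast.2 hN
  have h : √(1 / (N : ℝ)) ≤ (2 / (N : ℝ)) ^ (1 / 4 : ℝ) := by
    refine (pow_le_pow_iff_left₀ (Real.sqrt_nonneg _) (by positivity) four_ne_zero).1 ?_
    rw [← Real.rpow_mul_natCast (by positivity), show 4 = 2 * 2 from rfl, pow_mul,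
      Real.sq_sqrt (by positivity)]
    norm_num
    rw [div_eq_mul_inv, ← inv_pow, sq]
    have h1 : (N : ℝ)⁻¹ ≤ 1 := inv_le_one_of_one_le₀ hN'
    have h0 : 0 ≤ (N : ℝ)⁻¹ := by positivity
    nlinarith
  rw [div_eq_mul_one_div, mul_comm, Real.sqrt_mul (by positivity)]
  exact mul_le_mul_of_nonneg_right h (Real.sqrt_nonneg _)

end Rates

/-- The graph has no loops whereas `sampleDegree` includes the diagonal term, which is at most 1 and
costs `1 / N`. -/
theorem abs_vertexDegree_div_sub_sampleDegree_le (W : Graphon) {N : ℕ} (x : Fin N → I)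
    (g : SimpleGraph (Fin N)) (v : Fin N) {τ : ℝ}
    (h : |degreeDeviation (edgeProb W x) g v| ≤ N * τ) :
    |vertexDegree g v / N - W.sampleDegree (orderStat x) v| ≤ τ + 1 / N := by
  classical
  have hN : (0 : ℝ) < N := Nat.cast_pos.2 v.pos
  have hd : vertexDegree g v - ∑ j, W (orderStat x v) (orderStat x j) =
      degreeDeviation (edgeProb W x) g v - W (orderStat x v) (orderStat x v) := by
    have h1 : ∀ j, ((if g.Adj v j then (1 : ℝ) else 0) - W (orderStat x v) (orderStat x j)) =
        (if j = v then 0 else (if g.Adj v j then 1 else 0) - edgeProb W x v j) -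
          if j = v then W (orderStat x v) (orderStat x j) else 0 := by
      intro j
      by_cases hj : j = v
      · subst hj; simp
      · simp [hj, edgeProb]
    rw [vertexDegree, ← Finset.sum_sub_distrib, Finset.sum_congr rfl fun j _ => h1 j,
      Finset.sum_sub_distrib, Finset.sum_ite_eq']
    simp [degreeDeviation]
  rw [Graphon.sampleDegree, ← sub_div, hd, abs_div, abs_of_pos hN, div_le_iff₀ hN, add_mul,
    div_mul_cancel₀ _ hN.ne', mul_comm τ]
  exact (abs_sub _ _).trans (add_le_add h (W.abs_le_one _ _))

end

theorem proposition2 (W : Graphon) (L : ℝ) (K : ℕ) (α : Fin (K + 2) → ℝ)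
    (hW : W.IsPiecewiseLipschitz L K α)
    (ν : ℝ) (hν : ν < Real.exp (-1))
    (N : ℕ) (hN : 0 < N) (hlarge : W.LargeEnough L K α ν N)
    (hb : 2 * (K : ℝ) * bRate ν N ≤ 1)
    {Ω : Type*} [MeasurableSpace Ω] (P : Measure Ω) [IsProbabilityMeasure P]
    (X : Fin N → Ω → unitInterval) (G : Ω → SimpleGraph (Fin N))
    (hG : IsSampledGraph P W X G) :
    ENNReal.ofReal (1 - 2 * ν) ≤
      P {ω | ∃ π : Equiv.Perm (Fin N),
        l2Norm (fun x => eigenvalueStep (G ω) π x - W.degree x) ≤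
          (2 / (N : ℝ)) ^ (1 / 4 : ℝ) * √(W.opNorm + phiRate L K ν N) + phiRate L K ν N} := by
  have hN' : (0 : ℝ) < N := Nat.cast_pos.2 hN
  have hν0 : 0 < ν := lt_of_le_of_lt (by positivity) hlarge.exp
  -- For `N = 1` the exponential condition would give `exp (-1/5) < ν < exp (-1)`.
  have hN2 : 2 ≤ N := by
    by_contra! h
    obtain rfl : N = 1 := by omega
    have h1 := hlarge.exp
    have h2 : Real.exp (-1) ≤ Real.exp (-(1 : ℝ) / 5) := Real.exp_le_exp.2 (by norm_num)
    rw [Nat.cast_one, one_mul] at h1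
    linarith
  have hlog : 0 ≤ Real.log (2 * N / ν) := by
    rw [log_two_mul_div hν0 hN]
    linarith [one_le_log_div hν0 hν hN, Real.log_two_gt_d9]
  set δ := √(8 * Real.log (N / ν) / (N + 1)) with hδ
  set τ := √(2 * Real.log (2 * N / ν) / N) with hτ
  have hτ0 : 0 ≤ τ := Real.sqrt_nonneg _
  have hb0 : 0 ≤ bRate ν N := add_nonneg (by positivity) (Real.sqrt_nonneg _)
  set good := {ω | ∃ π : Equiv.Perm (Fin N),
    l2Norm (fun x => eigenvalueStep (G ω) π x - W.degree x) ≤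
      (2 / (N : ℝ)) ^ (1 / 4 : ℝ) * √(W.opNorm + phiRate L K ν N) + phiRate L K ν N} with hgood
  set far := {ω | ¬ ∀ i, ((orderStat (fun j => X j ω) i : I) : ℝ) < 1 ∧
      ∀ u ∈ cell N i, |((orderStat (fun j => X j ω) i : I) : ℝ) - u| ≤ 1 / N + δ} with hfar
  set dev : Fin N → Set Ω := fun v =>
    {ω | N * τ ≤ |degreeDeviation (edgeProb W fun i => X i ω) (G ω) v|} with hdev
  have hPfar : P far ≤ ENNReal.ofReal ν :=
    (measure_orderStat_far_le hG.measurable_latent hG.uniform hG.indep (Real.sqrt_nonneg _)).trans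
      (ENNReal.ofReal_le_ofReal (two_mul_exp_orderStat_le hν0 hν hN))
  have hPdev : P (⋃ v, dev v) ≤ ENNReal.ofReal ν := by
    refine (measure_iUnion_fintype_le _ _).trans ((Finset.sum_le_sum fun v _ =>
      hG.measure_le_abs_degreeDeviation_le v hτ0).trans_eq ?_)
    -- This is what fixes `τ`: the union bound over `N` vertices then totals exactly `ν`.
    have h1 : (N : ℝ) * τ ^ 2 / 2 = Real.log (2 * N / ν) := by
      rw [hτ, Real.sq_sqrt (by positivity)]; field_simp
    rw [h1, Finset.sum_const, Finset.card_univ, Fintype.card_fin, ← ENNReal.ofReal_nsmul,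
      nsmul_eq_mul]
    congr 1
    rw [← mul_assoc, mul_comm (N : ℝ)]
    exact exp_neg_log_two_mul_div hν0 hN
  have hcover : (univ : Set Ω) ⊆ good ∪ (far ∪ ⋃ v, dev v) := by
    intro ω _
    by_contra hcon
    simp only [mem_union, mem_iUnion, not_or, not_exists] at hcon
    obtain ⟨h1, h2, h3⟩ := hcon
    set y := orderStat fun j => X j ω with hy
    have h2' : ∀ i, (y i : ℝ) < 1 ∧ ∀ u ∈ cell N i, |(y i : ℝ) - u| ≤ bRate ν N :=
      not_not.1 h2
    have hdegree : ∀ v, |vertexDegree (G ω) v / N - W.sampleDegree y v| ≤ τ + 1 / N := fun v =>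
      abs_vertexDegree_div_sub_sampleDegree_le W _ _ v (not_le.1 (h3 v)).le
    have hφ : l2Norm (fun x => cellStep N (fun i => vertexDegree (G ω) i / N) x - W.degree x) ≤
        phiRate L K ν N := by
      have h := l2Norm_add_le
        ((memLp_cellStep hN fun i => vertexDegree (G ω) i / N).sub
          (memLp_cellStep hN (W.sampleDegree y)))
        ((memLp_cellStep hN (W.sampleDegree y)).sub W.memLp_degree)
      simp only [Pi.sub_apply, sub_add_sub_cancel] at h
      refine h.trans (add_le_add ?_ ?_)
      · rw [show cellStep N (fun i => vertexDegree (G ω) i / N) - cellStep N (W.sampleDegree y) =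
          cellStep N fun i => vertexDegree (G ω) i / N - W.sampleDegree y i from
          funext (cellStep_sub _ _)]
        refine (l2Norm_le_of_abs_le (by positivity) (abs_cellStep_le hN hdegree)).trans ?_
        exact sqrt_add_one_div_le hν0 hν hN2
      · exact hW.l2Norm_cellStep_sampleDegree_sub_degree_le hN hb0 hb (fun i => (h2' i).1)
          fun i => (h2' i).2
    obtain ⟨π, hπ⟩ := exists_perm_l2Norm_eigenvalueStep_sub_degree_le W hN (G ω) hφ
    exact h1 ⟨π, hπ.trans (add_le_add_left (sqrt_div_le_rpow_mul_sqrt hN) _)⟩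
  -- Subadditivity over the cover needs no measurability of `good`.
  have hone : 1 ≤ P good + (ENNReal.ofReal ν + ENNReal.ofReal ν) := by
    rw [← measure_univ (μ := P)]
    exact (measure_mono hcover).trans ((measure_union_le _ _).trans
      (add_le_add le_rfl ((measure_union_le _ _).trans (add_le_add hPfar hPdev))))
  rw [ENNReal.ofReal_sub _ (by positivity), ENNReal.ofReal_one, tsub_le_iff_right, two_mul,
    ENNReal.ofReal_add hν0.le hν0.le]
  exact hone
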